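/- A \emph{copula} is a function $C:[0,1]^2\to[0,1]$ with $C(u,0)=0=C(0,v)$, $C(u,1)=u$, $C(1,v)=v$ and $C(u,v)-C(u,y)-C(x,v)+C(x,y)\ge 0$ whenever $x\le u$, $y\le v$. Let $\Pi(x,y)=xy$ and $M(x,y)=\min(x,y)$. For real linear combinations $A,B$ of copulas put $$(A*B)(x,y)=\int_0^1\partial_2A(x,t)\,\partial_1B(t,y)\,dt,\qquad \|A\|=\Big(\int_0^1\!\!\int_0^1\big((\partial_1A)^2+(\partial_2A)^2\big)\,dx\,dy\Big)^{1/2}.$$ A copula $U$ is \emph{invertible} if there is a copula $V$ with $V*U=U*V=M$, and $\|A\|_*=\sup\|U*A*V\|$, the supremum being over all invertible copulas $U,V$. A real random variable is \emph{continuous} if its distribution function is continuous. The copula $C_{X,Y}$ of continuous random variables $X,Y$ on a common probability space, with distribution functions $F$ and $G$, is the unique copula with $P(X\le x,\,Y\le y)=C_{X,Y}(F(x),G(y))$ for all $x,y\in\mathbb R$. Put $\omega_*(X,Y)=\sqrt3\,\|C_{X,Y}-\Pi\|_*$. We say that $Y$ is \emph{completely dependent} on $X$ if $Y=h(X)$ almost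 surely for some Borel measurable $h:\mathbb R\to\mathbb R$. \textbf{Theorem.} Let $X$ and $Y$ be continuous random variables with copula $C$. Then $\omega_*(X,Y)$ is well defined (the supremum $\|C-\Pi\|_*$ is finite) and has the following properties. \begin{enumerate} \item $\omega_*(X,Y)=\omega_*(Y,X)$. \item $0\le\omega_*(X,Y)\le1$. \item $\omega_*(X,Y)=0$ if and only if $X$ and $Y$ are independent. \item $\omega_*(X,Y)=1$ if $Y$ is completely dependent on $X$ or $X$ is completely dependent on $Y$. \item If $f,g:\mathbb R\to\mathbb R$ are Borel measurable bijections, then $f(X)$ and $g(Y)$ are continuous random variables and $\omega_*(f(X),g(Y))=\omega_*(X,Y)$. \item If $(X_n,Y_n)_{n\in\mathbb N}$ is a sequence of pairs of continuous random variables with copulas $C_n$ (the pairs may live on different probability spaces) and $\lim_{n\to\infty}\|C_n-C\|_*=0$, then $\lim_{n\to\infty}\omega_*(X_n,Y_n)=\omega_*(X,Y)$. \end{enumerate} -/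

import Mathlib

open MeasureTheory ProbabilityTheory Filter Topology

noncomputable section

/-- A bivariate copula, as a function on the unit square. -/
structure IsCopula (C : unitInterval → unitInterval → ℝ) : Prop where
  right_zero : ∀ u, C u 0 = 0
  left_zero : ∀ v, C 0 v = 0
  right_one : ∀ u, C u 1 = (u : ℝ)
  left_one : ∀ v, C 1 v = (v : ℝ)
  two_increasing : ∀ x u y v, x ≤ u → y ≤ v → 0 ≤ C u v - C u y - C x v + C x y

/-- The values of a copula lie in `[0,1]`. -/
theorem IsCopula.mem_Icc {C : unitInterval → unitInterval → ℝ} (hC : IsCopula C)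
    (u v : unitInterval) : C u v ∈ Set.Icc (0 : ℝ) 1 := by
  have h1 := hC.two_increasing 0 u 0 v u.2.1 v.2.1
  have h2 := hC.two_increasing u 1 0 v u.2.2 v.2.1
  have h3 := v.2.2
  simp only [hC.right_zero, hC.left_zero, hC.left_one] at h1 h2
  exact ⟨by linarith, by linarith⟩

/-- The independence copula `Π(x,y) = xy`. -/
def copulaPi : unitInterval → unitInterval → ℝ := fun x y => (x : ℝ) * (y : ℝ)

/-- The Fréchet–Hoeffding upper bound `M(x,y) = min(x,y)`. -/
def copulaM : unitInterval → unitInterval → ℝ := fun x y => min (x : ℝ) (y : ℝ)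

/-- The point of `[0,1]` closest to a real number; it is the identity on `[0,1]`. -/
def clampI (t : ℝ) : unitInterval := Set.projIcc (0 : ℝ) 1 zero_le_one t

/-- The partial derivative `∂₁A(x,y)`; only points with `0 < x < 1` matter below, and near such a
point the clamping does nothing. -/
def partialFst (A : unitInterval → unitInterval → ℝ) (x : ℝ) (y : unitInterval) : ℝ :=
  deriv (fun s : ℝ => A (clampI s) y) x

/-- The partial derivative `∂₂A(x,y)`; only points with `0 < y < 1` matter below. -/
def partialSnd (A : unitInterval → unitInterval → ℝ) (x : unitInterval) (y : ℝ) : ℝ :=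
  deriv (fun s : ℝ => A x (clampI s)) y

/-- The product `(A * B)(x,y) = ∫₀¹ ∂₂A(x,t) ∂₁B(t,y) dt`. -/
def starProd (A B : unitInterval → unitInterval → ℝ) : unitInterval → unitInterval → ℝ :=
  fun x y => ∫ t in (0 : ℝ)..1, partialSnd A x t * partialFst B t y

/-- The Sobolev norm `(∫₀¹ ∫₀¹ |∇A(x,y)|² dx dy)^(1/2)`. -/
def sobolevNorm (A : unitInterval → unitInterval → ℝ) : ℝ :=
  Real.sqrt (∫ x in (0 : ℝ)..1, ∫ y in (0 : ℝ)..1,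
    ((partialFst A x (clampI y)) ^ 2 + (partialSnd A (clampI x) y) ^ 2))

/-- Copulas that are invertible with respect to the product `*`, whose identity is `M`. -/
def IsInvertibleCopula (U : unitInterval → unitInterval → ℝ) : Prop :=
  IsCopula U ∧ ∃ V, IsCopula V ∧ starProd V U = copulaM ∧ starProd U V = copulaM

/-- The Sobolev norms `‖U * A * V‖` of the images of `A` under all shuffling maps. -/
def shuffleNorms (A : unitInterval → unitInterval → ℝ) : Set ℝ :=
  {r | ∃ U V, IsInvertibleCopula U ∧ IsInvertibleCopula V ∧
    r = sobolevNorm (starProd (starProd U A) V)}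

/-- The `*`-norm `‖A‖_* = sup ‖U * A * V‖` over invertible copulas `U`, `V`. -/
def starNorm (A : unitInterval → unitInterval → ℝ) : ℝ := sSup (shuffleNorms A)

section RandomVariables

variable {Ω : Type*} [MeasurableSpace Ω]

/-- The distribution function `x ↦ P(X ≤ x)`, with values in `[0,1]`. -/
def distFun (P : Measure Ω) [IsProbabilityMeasure P] (X : Ω → ℝ) (x : ℝ) : unitInterval :=
  ⟨P.real {ω | X ω ≤ x}, measureReal_nonneg, measureReal_le_one⟩

/-- A continuous random variable: its distribution function is continuous. -/
def IsContinuousRV (P : Measure Ω) [IsProbabilityMeasure P] (X : Ω → ℝ) : Prop :=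
  Measurable X ∧ Continuous (distFun P X)

/-- `C` is a copula of `X` and `Y`: `P(X ≤ x, Y ≤ y) = C(F(x), G(y))` for all real `x`, `y`. -/
def IsCopulaOf (P : Measure Ω) [IsProbabilityMeasure P] (X Y : Ω → ℝ)
    (C : unitInterval → unitInterval → ℝ) : Prop :=
  IsCopula C ∧ ∀ x y : ℝ, P.real {ω | X ω ≤ x ∧ Y ω ≤ y} = C (distFun P X x) (distFun P Y y)

/-- The copula of continuous random variables `X` and `Y`, as the joint distribution function of
`F(X)` and `G(Y)`. It is the unique copula of `X` and `Y`: see `isCopulaOf_copulaOf` and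
`IsCopulaOf.eq_copulaOf` below. -/
def copulaOf (P : Measure Ω) [IsProbabilityMeasure P] (X Y : Ω → ℝ) :
    unitInterval → unitInterval → ℝ :=
  fun u v => P.real {ω | distFun P X (X ω) ≤ u ∧ distFun P Y (Y ω) ≤ v}

theorem distFun_mono (P : Measure Ω) [IsProbabilityMeasure P] (X : Ω → ℝ) :
    Monotone (distFun P X) := fun _ _ h =>
  Subtype.mk_le_mk.2 (measureReal_mono fun _ hω => le_trans hω h)

theorem distFun_coe_eq_cdf (P : Measure Ω) [IsProbabilityMeasure P] {X : Ω → ℝ}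
    (hX : Measurable X) (x : ℝ) : (distFun P X x : ℝ) = cdf (P.map X) x := by
  have := Measure.isProbabilityMeasure_map (μ := P) hX.aemeasurable
  rw [cdf_eq_real, map_measureReal_apply hX measurableSet_Iic]
  rfl

/-- The sublevel sets of a continuous distribution function. -/
theorem distFun_sublevel (P : Measure Ω) [IsProbabilityMeasure P] {X : Ω → ℝ}
    (hX : IsContinuousRV P X) (u : unitInterval) :
    (u = 1 ∨ (u = 0 ∧ ∀ z, ¬ distFun P X z ≤ u)) ∨
      ∃ x, distFun P X x = u ∧ ∀ z, distFun P X z ≤ u ↔ z ≤ x := by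
  obtain ⟨hm, hc⟩ := hX
  have := Measure.isProbabilityMeasure_map (μ := P) hm.aemeasurable
  by_cases h1 : u = 1
  · exact Or.inl (Or.inl h1)
  by_cases hS : ∀ z, ¬ distFun P X z ≤ u
  · refine Or.inl (Or.inr ⟨?_, hS⟩)
    refine le_antisymm ?_ u.2.1
    have ht : Tendsto (fun z => cdf (P.map X) z) atBot (𝓝 0) := tendsto_cdf_atBot _
    refine Subtype.coe_le_coe.1 (ge_of_tendsto' ht fun z => ?_)
    rw [← distFun_coe_eq_cdf P hm]
    exact (Subtype.coe_lt_coe.2 (not_le.1 (hS z))).le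
  right
  push Not at hS
  have hu : (u : ℝ) < 1 := lt_of_le_of_ne u.2.2 fun h => h1 (Subtype.ext h)
  have ht : Tendsto (fun z => cdf (P.map X) z) atTop (𝓝 1) := tendsto_cdf_atTop _
  obtain ⟨b, hb⟩ := (ht.eventually_const_lt hu).exists
  rw [← distFun_coe_eq_cdf P hm] at hb
  have hbdd : BddAbove {z | distFun P X z ≤ u} := ⟨b, fun z hz => by
    by_contra hlt
    exact absurd (Subtype.coe_lt_coe.1 hb)
      (not_lt.2 ((distFun_mono P X (not_le.1 hlt).le).trans hz))⟩
  have hcl : IsClosed {z | distFun P X z ≤ u} := isClosed_le hc continuous_const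
  have hmem := hcl.csSup_mem hS hbdd
  set x := sSup {z | distFun P X z ≤ u}
  refine ⟨x, le_antisymm hmem ?_, fun z => ⟨fun hz => le_csSup hbdd hz,
    fun hz => (distFun_mono P X hz).trans hmem⟩⟩
  have hlim : Tendsto (distFun P X) (𝓝[>] x) (𝓝 (distFun P X x)) :=
    hc.continuousAt.tendsto.mono_left nhdsWithin_le_nhds
  refine ge_of_tendsto hlim ?_
  filter_upwards [self_mem_nhdsWithin] with z hz
  by_contra hlt
  exact absurd (le_csSup hbdd (show z ∈ {z | distFun P X z ≤ u} from (not_le.1 hlt).le))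
    (not_le.2 hz)

/-- The probability integral transform `F(X)` is uniformly distributed. -/
theorem prob_distFun_le (P : Measure Ω) [IsProbabilityMeasure P] {X : Ω → ℝ}
    (hX : IsContinuousRV P X) (u : unitInterval) :
    P.real {ω | distFun P X (X ω) ≤ u} = u := by
  rcases distFun_sublevel P hX u with (rfl | ⟨rfl, h⟩) | ⟨x, hx, h⟩
  · have : {ω | distFun P X (X ω) ≤ 1} = Set.univ :=
      Set.eq_univ_of_forall fun ω => unitInterval.le_one'
    simp [this]
  · simp [h]
  · simp only [h]
    exact congrArg Subtype.val hx

/-- Sklar's theorem, existence: `copulaOf P X Y` is a copula of `X` and `Y`. -/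
theorem isCopulaOf_copulaOf (P : Measure Ω) [IsProbabilityMeasure P] {X Y : Ω → ℝ}
    (hX : IsContinuousRV P X) (hY : IsContinuousRV P Y) :
    IsCopulaOf P X Y (copulaOf P X Y) := by
  have hmX : Measurable fun ω => distFun P X (X ω) := hX.2.measurable.comp hX.1
  have hmY : Measurable fun ω => distFun P Y (Y ω) := hY.2.measurable.comp hY.1
  have hsX : ∀ u, MeasurableSet {ω | distFun P X (X ω) ≤ u} := fun u => hmX measurableSet_Iic
  have hsY : ∀ u, MeasurableSet {ω | distFun P Y (Y ω) ≤ u} := fun u => hmY measurableSet_Iic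
  refine ⟨⟨fun u => ?_, fun v => ?_, fun u => ?_, fun v => ?_, fun x u y v hxu hyv => ?_⟩,
    fun x y => ?_⟩
  · refine le_antisymm ?_ measureReal_nonneg
    exact (measureReal_mono fun ω h => h.2).trans_eq (prob_distFun_le P hY 0)
  · refine le_antisymm ?_ measureReal_nonneg
    exact (measureReal_mono fun ω h => h.1).trans_eq (prob_distFun_le P hX 0)
  · simpa [copulaOf, unitInterval.le_one'] using prob_distFun_le P hX u
  · simpa [copulaOf, unitInterval.le_one'] using prob_distFun_le P hY v
  · have key : ∀ w : unitInterval, copulaOf P X Y w v - copulaOf P X Y w y =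
        P.real ({ω | distFun P X (X ω) ≤ w} ∩
          ({ω | distFun P Y (Y ω) ≤ v} \ {ω | distFun P Y (Y ω) ≤ y})) := by
      intro w
      rw [Set.inter_sdiff_distrib_left, measureReal_sdiff]
      · rfl
      · exact fun ω h => ⟨h.1, le_trans h.2 hyv⟩
      · exact (hsX w).inter (hsY y)
    have hle : copulaOf P X Y x v - copulaOf P X Y x y ≤
        copulaOf P X Y u v - copulaOf P X Y u y := by
      rw [key, key]
      exact measureReal_mono fun ω h => ⟨le_trans h.1 hxu, h.2⟩
    linarith
  · have ae : ∀ {Z : Ω → ℝ}, IsContinuousRV P Z → ∀ z : ℝ,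
        {ω | Z ω ≤ z} =ᵐ[P] {ω | distFun P Z (Z ω) ≤ distFun P Z z} := by
      intro Z hZ z
      refine ae_eq_of_subset_of_measure_ge (fun ω h => distFun_mono P Z h) ?_
        (hZ.1 measurableSet_Iic).nullMeasurableSet (measure_ne_top _ _)
      refine (ENNReal.toReal_le_toReal (measure_ne_top _ _) (measure_ne_top _ _)).1 ?_
      exact (prob_distFun_le P hZ (distFun P Z z)).le
    exact measureReal_congr ((ae hX x).inter (ae hY y))

/-- Sklar's theorem, uniqueness. -/
theorem IsCopulaOf.eq_copulaOf {P : Measure Ω} [IsProbabilityMeasure P] {X Y : Ω → ℝ}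
    {C : unitInterval → unitInterval → ℝ} (hX : IsContinuousRV P X) (hY : IsContinuousRV P Y)
    (hC : IsCopulaOf P X Y C) : C = copulaOf P X Y := by
  obtain ⟨hD, hD'⟩ := isCopulaOf_copulaOf P hX hY
  obtain ⟨hC, hC'⟩ := hC
  funext u v
  rcases distFun_sublevel P hX u with (rfl | ⟨rfl, -⟩) | ⟨x, rfl, -⟩
  · rw [hC.left_one, hD.left_one]
  · rw [hC.left_zero, hD.left_zero]
  rcases distFun_sublevel P hY v with (rfl | ⟨rfl, -⟩) | ⟨y, rfl, -⟩
  · rw [hC.right_one, hD.right_one]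
  · rw [hC.right_zero, hD.right_zero]
  rw [← hC', ← hD']

/-- The measure of dependence `ω_*(X,Y) = √3 ‖C_{X,Y} - Π‖_*`. -/
def omegaStar (P : Measure Ω) [IsProbabilityMeasure P] (X Y : Ω → ℝ) : ℝ :=
  Real.sqrt 3 * starNorm (copulaOf P X Y - copulaPi)

/-- `Y` is completely dependent on `X`: `Y = h(X)` almost surely for some Borel function `h`. -/
def CompletelyDependentOn (P : Measure Ω) (Y X : Ω → ℝ) : Prop :=
  ∃ h : ℝ → ℝ, Measurable h ∧ ∀ᵐ ω ∂P, Y ω = h (X ω)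

end RandomVariables

end

/-! ### Clamping and partial derivatives of separately Lipschitz functions -/

open scoped NNReal

/-! A copula is 1-Lipschitz in each variable, so its partial derivatives exist almost everywhere,
lie in [0,1] and integrate back to it. Hence copulas are closed under `*`, M is the unit and Π
absorbs every copula. Therefore U * (C - Π) * V = U * C * V - Π, and each shuffled norm is the norm
of a copula minus Π.

With Dᵀ the transpose of a copula D, the integral of ∂₁D(t,y)² over t is (Dᵀ * D)(y,y). Absorption
by Π turns this into (Dᵀ * D)(y,y) - y² for D - Π, which is at most y - y², with integral 1/6. The
two partial derivatives contribute at most 1/3 together: this is the factor √3. If the norm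
vanishes, continuity of the diagonal forces D = Π.

Shuffles are handled through random variables. The value ∂₁C_{X,W}(F(X),w) is the conditional
probability, given X, that the uniform transform of W is at most w, so C_{Z,X} * C_{X,W} = C_{Z,W}
whenever Z is a function of X. An injective Borel f has a Borel left inverse, hence C_{f(X),X} is
invertible and C_{f(X),g(Y)} is a shuffle of C_{X,Y}. Associativity of `*` has the same source:
every copula is realised by a pair of random variables, and both bracketings of a triple product are
one expectation.

If Y = h(X), then Cᵀ * C = C_{Y,Y} = M, so the ∂₁ energy is exactly 1/6 for C and its left shuffles.
The ∂₂ energy approaches 1/6 under shuffles that sort X by blocks of G(Y) of length 1/(n+1). The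
limit statement is the reverse triangle inequality, which rests on Minkowski's inequality for
gradients. -/

theorem clampI_of_mem (t : unitInterval) : clampI (t : ℝ) = t := Set.projIcc_val _ t

theorem clampI_zero : clampI 0 = 0 := clampI_of_mem 0

theorem clampI_one : clampI 1 = 1 := clampI_of_mem 1

theorem coe_clampI {t : ℝ} (h0 : 0 ≤ t) (h1 : t ≤ 1) : (clampI t : ℝ) = t := by
  have := clampI_of_mem ⟨t, h0, h1⟩
  exact congrArg Subtype.val this

theorem clampI_mono : Monotone clampI := Set.monotone_projIcc zero_le_one

theorem continuous_clampI : Continuous clampI :=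
  continuous_projIcc (h := zero_le_one)

theorem lipschitzWith_clampI : LipschitzWith 1 clampI := LipschitzWith.projIcc zero_le_one

/-- Lipschitz in each variable separately. -/
structure SepLipschitz (K : ℝ≥0) (A : unitInterval → unitInterval → ℝ) : Prop where
  left : ∀ y, LipschitzWith K fun x => A x y
  right : ∀ x, LipschitzWith K (A x)

namespace SepLipschitz

variable {K K' : ℝ≥0} {A B : unitInterval → unitInterval → ℝ}

theorem flip (h : SepLipschitz K A) : SepLipschitz K (flip A) := ⟨h.right, h.left⟩

theorem sub (h : SepLipschitz K A) (h' : SepLipschitz K' B) : SepLipschitz (K + K') (A - B) :=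
  ⟨fun y => (h.left y).sub (h'.left y), fun x => (h.right x).sub (h'.right x)⟩

theorem continuous_uncurry (h : SepLipschitz K A) : Continuous (Function.uncurry A) :=
  (LipschitzWith.uncurry h.left h.right).continuous

theorem lipschitz_section (h : SepLipschitz K A) (y : unitInterval) :
    LipschitzWith K fun s : ℝ => A (clampI s) y :=
  mul_one K ▸ (h.left y).comp lipschitzWith_clampI

theorem integral_partialFst (h : SepLipschitz K A) (y : unitInterval) (a b : ℝ) :
    ∫ t in a..b, partialFst A t y = A (clampI b) y - A (clampI a) y :=
  ((h.lipschitz_section y).lipschitzOnWith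
    (s := Set.uIcc a b)).absolutelyContinuousOnInterval.integral_deriv_eq_sub

/-- `deriv` is 0 where no derivative exists, so the bound needs no exceptional set. -/
theorem abs_partialFst_le (h : SepLipschitz K A) (t : ℝ) (y : unitInterval) :
    |partialFst A t y| ≤ K :=
  norm_deriv_le_of_lipschitz (h.lipschitz_section y)

theorem ae_differentiableAt (h : SepLipschitz K A) (y : unitInterval) :
    ∀ᵐ t : ℝ, DifferentiableAt ℝ (fun s : ℝ => A (clampI s) y) t :=
  (h.lipschitz_section y).ae_differentiableAt_real

theorem partialFst_sub_ae (h : SepLipschitz K A) (h' : SepLipschitz K' B) (y : unitInterval) :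
    ∀ᵐ t : ℝ, partialFst (A - B) t y = partialFst A t y - partialFst B t y := by
  filter_upwards [h.ae_differentiableAt y, h'.ae_differentiableAt y] with t ht ht'
  exact deriv_sub ht ht'

theorem measurable_partialFst_uncurry (h : SepLipschitz K A) :
    Measurable fun p : ℝ × unitInterval => partialFst A p.1 p.2 := by
  have hc : Continuous (Function.uncurry fun (y : unitInterval) (s : ℝ) => A (clampI s) y) :=
    h.continuous_uncurry.comp ((continuous_clampI.comp continuous_snd).prodMk continuous_fst)
  exact (measurable_deriv_with_param hc).comp measurable_swap

theorem measurable_partialFst (h : SepLipschitz K A) (y : unitInterval) :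
    Measurable fun t : ℝ => partialFst A t y :=
  h.measurable_partialFst_uncurry.comp (measurable_id.prodMk measurable_const)

end SepLipschitz

/-- A bounded measurable function is integrable on every bounded interval. -/
theorem intervalIntegrable_of_abs_le {f : ℝ → ℝ} (hf : Measurable f) {K : ℝ}
    (hK : ∀ t, |f t| ≤ K) (a b : ℝ) : IntervalIntegrable f volume a b :=
  (intervalIntegrable_const (c := K)).mono_fun hf.aestronglyMeasurable
    (ae_of_all _ fun t => (hK t).trans (le_abs_self K))

namespace SepLipschitz

variable {K K' : ℝ≥0} {A B : unitInterval → unitInterval → ℝ}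

theorem intervalIntegrable_partialFst (h : SepLipschitz K A) (y : unitInterval) (a b : ℝ) :
    IntervalIntegrable (fun t => partialFst A t y) volume a b :=
  intervalIntegrable_of_abs_le (h.measurable_partialFst y) (fun t => h.abs_partialFst_le t y) a b

theorem intervalIntegrable_mul (h : SepLipschitz K A) (h' : SepLipschitz K' B)
    (x y : unitInterval) (a b : ℝ) :
    IntervalIntegrable (fun t => partialSnd A x t * partialFst B t y) volume a b := by
  refine intervalIntegrable_of_abs_le (K := K * K')
    ((h.flip.measurable_partialFst x).mul (h'.measurable_partialFst y)) (fun t => ?_) a b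
  simp only [Pi.mul_apply, abs_mul]
  exact mul_le_mul (h.flip.abs_partialFst_le t x) (h'.abs_partialFst_le t y) (abs_nonneg _) K.2

end SepLipschitz

/-! ### Monotonicity, Lipschitz bounds and derivatives of copulas -/

namespace IsCopula

variable {C D : unitInterval → unitInterval → ℝ}

theorem flip (hC : IsCopula C) : IsCopula (flip C) :=
  ⟨hC.left_zero, hC.right_zero, hC.left_one, hC.right_one, fun x u y v hxu hyv => by
    have := hC.two_increasing y v x u hyv hxu
    simp only [_root_.flip]; linarith⟩

theorem mono_left (hC : IsCopula C) (y : unitInterval) : Monotone fun x => C x y := fun x u h => by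
  have := hC.two_increasing x u 0 y h y.2.1
  rw [hC.right_zero, hC.right_zero] at this
  simp only; linarith

theorem sub_le (hC : IsCopula C) {x u : unitInterval} (h : x ≤ u) (y : unitInterval) :
    C u y - C x y ≤ u - x := by
  have := hC.two_increasing x u y 1 h y.2.2
  rw [hC.right_one, hC.right_one] at this
  linarith

theorem lipschitzWith_left (hC : IsCopula C) (y : unitInterval) :
    LipschitzWith 1 fun x => C x y := by
  refine LipschitzWith.of_le_add_mul 1 fun x u => ?_
  rcases le_total x u with h | h
  · have := hC.mono_left y h
    have h2 : (0 : ℝ) ≤ ((1 : ℝ≥0) : ℝ) * dist x u := by positivity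
    simp only at this; linarith
  · have := hC.sub_le h y
    have h2 : dist x u = x - u := by
      rw [Subtype.dist_eq, Real.dist_eq, abs_of_nonneg]
      exact sub_nonneg.2 h
    rw [h2]; simp only [NNReal.coe_one]; linarith

theorem sepLipschitz (hC : IsCopula C) : SepLipschitz 1 C :=
  ⟨hC.lipschitzWith_left, hC.flip.lipschitzWith_left⟩

theorem partialFst_nonneg (hC : IsCopula C) (t : ℝ) (y : unitInterval) : 0 ≤ partialFst C t y :=
  Monotone.deriv_nonneg ((hC.mono_left y).comp clampI_mono)

theorem partialFst_le_one (hC : IsCopula C) (t : ℝ) (y : unitInterval) : partialFst C t y ≤ 1 :=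
  (le_abs_self _).trans (hC.sepLipschitz.abs_partialFst_le t y)

theorem integral_partialFst_Icc (hC : IsCopula C) (x y : unitInterval) :
    ∫ t in (0 : ℝ)..x, partialFst C t y = C x y := by
  rw [hC.sepLipschitz.integral_partialFst, clampI_of_mem, clampI_zero, hC.left_zero, sub_zero]

theorem partialFst_one (hC : IsCopula C) {t : ℝ} (h0 : 0 < t) (h1 : t < 1) :
    partialFst C t 1 = 1 := by
  have : (fun s : ℝ => C (clampI s) 1) =ᶠ[𝓝 t] fun s => s := by
    filter_upwards [Ioo_mem_nhds h0 h1] with s hs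
    rw [hC.right_one, coe_clampI hs.1.le hs.2.le]
  rw [partialFst, this.deriv_eq, deriv_id'']

theorem partialFst_zero (hC : IsCopula C) (t : ℝ) : partialFst C t 0 = 0 := by
  simp [partialFst, hC.right_zero]

/-- Being 2-increasing says that C(·,v) - C(·,y) is nondecreasing, so its derivative is nonnegative
wherever both terms are differentiable. The exceptional set depends on y and v. -/
theorem partialFst_mono_ae (hC : IsCopula C) {y v : unitInterval} (h : y ≤ v) :
    ∀ᵐ t : ℝ, partialFst C t y ≤ partialFst C t v := by
  filter_upwards [hC.sepLipschitz.ae_differentiableAt y, hC.sepLipschitz.ae_differentiableAt v]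
    with t hy hv
  have hm : Monotone ((fun s : ℝ => C (clampI s) v) - fun s : ℝ => C (clampI s) y) := by
    intro a b hab
    have := hC.two_increasing _ _ y v (clampI_mono hab) h
    simp only [Pi.sub_apply]; linarith
  have := hm.deriv_nonneg (x := t)
  rw [deriv_sub hv hy] at this
  exact sub_nonneg.1 this

end IsCopula

/-! ### The product of copulas -/

/-- Transposition reverses products, so each one-sided fact about `*` yields its mirror image. -/
theorem starProd_flip_flip (A B : unitInterval → unitInterval → ℝ) :
    starProd (flip B) (flip A) = flip (starProd A B) := by
  funext x y
  exact intervalIntegral.integral_congr fun t _ => mul_comm _ _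

theorem starProd_sub_right {K₁ K₂ K₃ : ℝ≥0} {U A B : unitInterval → unitInterval → ℝ}
    (hU : SepLipschitz K₁ U) (hA : SepLipschitz K₂ A) (hB : SepLipschitz K₃ B) :
    starProd U (A - B) = starProd U A - starProd U B := by
  funext x y
  simp only [starProd, Pi.sub_apply]
  rw [← intervalIntegral.integral_sub (hU.intervalIntegrable_mul hA x y 0 1)
    (hU.intervalIntegrable_mul hB x y 0 1)]
  refine intervalIntegral.integral_congr_ae ?_
  filter_upwards [hA.partialFst_sub_ae hB y] with t ht _
  rw [ht, mul_sub]

theorem starProd_sub_left {K₁ K₂ K₃ : ℝ≥0} {V A B : unitInterval → unitInterval → ℝ}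
    (hV : SepLipschitz K₁ V) (hA : SepLipschitz K₂ A) (hB : SepLipschitz K₃ B) :
    starProd (A - B) V = starProd A V - starProd B V := by
  have := starProd_sub_right hV.flip hA.flip hB.flip
  rw [starProd_flip_flip, starProd_flip_flip] at this
  have h2 := starProd_flip_flip (A - B) V
  exact congrArg flip (h2.symm.trans this)

namespace IsCopula

variable {A B C : unitInterval → unitInterval → ℝ}

theorem intervalIntegrable_mul (hA : IsCopula A) (hB : IsCopula B) (x y : unitInterval) :
    IntervalIntegrable (fun t => partialSnd A x t * partialFst B t y) volume 0 1 :=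
  hA.sepLipschitz.intervalIntegrable_mul hB.sepLipschitz x y 0 1

theorem starProd_zero_right (hB : IsCopula B) (x : unitInterval) : starProd A B x 0 = 0 := by
  simp [starProd, hB.partialFst_zero]

theorem starProd_one_right (hA : IsCopula A) (hB : IsCopula B) (x : unitInterval) :
    starProd A B x 1 = x := by
  have h : starProd A B x 1 = ∫ t in (0 : ℝ)..1, partialSnd A x t := by
    refine intervalIntegral.integral_congr_ae ?_
    have : ∀ᵐ t : ℝ, t ≠ 1 := by simp [ae_iff]
    filter_upwards [this] with t ht1 ht
    rw [Set.uIoc_of_le zero_le_one] at ht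
    rw [hB.partialFst_one ht.1 (lt_of_le_of_ne ht.2 ht1), mul_one]
  rw [h]
  have := hA.flip.integral_partialFst_Icc 1 x
  rw [hA.flip.left_one] at this
  exact this

theorem starProd (hA : IsCopula A) (hB : IsCopula B) : IsCopula (starProd A B) := by
  refine ⟨hB.starProd_zero_right, fun v => ?_, hA.starProd_one_right hB, fun v => ?_,
    fun x u y v hxu hyv => ?_⟩
  · have := hA.flip.starProd_zero_right (A := _root_.flip B) v
    rwa [starProd_flip_flip] at this
  · have := hB.flip.starProd_one_right hA.flip v
    rwa [starProd_flip_flip] at this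
  · have i := fun x y => hA.intervalIntegrable_mul hB x y
    simp only [_root_.starProd]
    rw [← intervalIntegral.integral_sub (i _ _) (i _ _),
      ← intervalIntegral.integral_sub ((i _ _).sub (i _ _)) (i _ _),
      ← intervalIntegral.integral_add (((i _ _).sub (i _ _)).sub (i _ _)) (i _ _)]
    refine intervalIntegral.integral_nonneg_of_ae zero_le_one ?_
    filter_upwards [hA.flip.partialFst_mono_ae hxu, hB.partialFst_mono_ae hyv] with t h1 h2
    have h1 : partialSnd A x t ≤ partialSnd A u t := h1
    simp only [Pi.zero_apply]
    -- The combined integrand factors as (∂₂A(u,t) - ∂₂A(x,t)) (∂₁B(t,v) - ∂₁B(t,y)).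
    nlinarith [mul_nonneg (sub_nonneg.2 h1) (sub_nonneg.2 h2)]

end IsCopula

/-! ### M as unit and Π as absorbing element -/

theorem flip_copulaM : flip copulaM = copulaM := by
  funext x y; exact min_comm _ _

theorem flip_copulaPi : flip copulaPi = copulaPi := by
  funext x y; exact mul_comm _ _

theorem isCopula_copulaM : IsCopula copulaM := by
  refine ⟨fun u => ?_, fun u => ?_, fun u => ?_, fun u => ?_, fun x u y v hxu hyv => ?_⟩
  · simpa [copulaM] using u.2.1
  · simpa [copulaM] using u.2.1
  · simpa [copulaM] using u.2.2
  · simpa [copulaM] using u.2.2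
  · have h1 : (x : ℝ) ≤ u := hxu
    have h2 : (y : ℝ) ≤ v := hyv
    simp only [copulaM, min_def]
    split_ifs <;> linarith

theorem isCopula_copulaPi : IsCopula copulaPi := by
  refine ⟨fun u => ?_, fun u => ?_, fun u => ?_, fun u => ?_, fun x u y v hxu hyv => ?_⟩
  iterate 4 simp [copulaPi]
  have h1 : (x : ℝ) ≤ u := hxu
  have h2 : (y : ℝ) ≤ v := hyv
  simp only [copulaPi]
  nlinarith [mul_nonneg (sub_nonneg.2 h1) (sub_nonneg.2 h2)]

theorem partialFst_copulaPi {t : ℝ} (h0 : 0 < t) (h1 : t < 1) (y : unitInterval) :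
    partialFst copulaPi t y = y := by
  have : (fun s : ℝ => copulaPi (clampI s) y) =ᶠ[𝓝 t] fun s => s * y := by
    filter_upwards [Ioo_mem_nhds h0 h1] with s hs
    rw [copulaPi, coe_clampI hs.1.le hs.2.le]
  rw [partialFst, this.deriv_eq]
  simp

theorem partialFst_copulaM_of_lt {t : ℝ} (h0 : 0 < t) {y : unitInterval} (h1 : t < y) :
    partialFst copulaM t y = 1 := by
  have : (fun s : ℝ => copulaM (clampI s) y) =ᶠ[𝓝 t] fun s => s := by
    filter_upwards [Ioo_mem_nhds h0 h1] with s hs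
    rw [copulaM, coe_clampI hs.1.le (hs.2.le.trans y.2.2), min_eq_left hs.2.le]
  rw [partialFst, this.deriv_eq, deriv_id'']

theorem partialFst_copulaM_of_gt {t : ℝ} (h0 : t < 1) {y : unitInterval} (h1 : y < t) :
    partialFst copulaM t y = 0 := by
  have : (fun s : ℝ => copulaM (clampI s) y) =ᶠ[𝓝 t] fun s => y := by
    filter_upwards [Ioo_mem_nhds h1 h0] with s hs
    rw [copulaM, coe_clampI (y.2.1.trans hs.1.le) hs.2.le, min_eq_right hs.1.le]
  rw [partialFst, this.deriv_eq, deriv_const]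

namespace IsCopula

variable {A B C : unitInterval → unitInterval → ℝ}

/-- For almost every t, ∂₂M(x,t) is 1 for t < x and 0 for t > x, so the product integrates ∂₁A(·,y)
from 0 to x. -/
theorem copulaM_starProd (hA : IsCopula A) : _root_.starProd copulaM A = A := by
  funext x y
  have i := fun x y => isCopula_copulaM.intervalIntegrable_mul hA x y
  have hx : Set.uIcc (0 : ℝ) x ⊆ Set.uIcc 0 1 := by
    rw [Set.uIcc_of_le x.2.1, Set.uIcc_of_le zero_le_one]
    exact Set.Icc_subset_Icc_right x.2.2
  have hx' : Set.uIcc (x : ℝ) 1 ⊆ Set.uIcc 0 1 := by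
    rw [Set.uIcc_of_le x.2.2, Set.uIcc_of_le zero_le_one]
    exact Set.Icc_subset_Icc_left x.2.1
  have hM : ∀ t, partialSnd copulaM x t = partialFst copulaM t x := fun t => by
    conv_rhs => rw [← flip_copulaM]
    rfl
  rw [_root_.starProd, ← intervalIntegral.integral_add_adjacent_intervals
    ((i x y).mono_set hx) ((i x y).mono_set hx')]
  have h1 : ∫ t in (0 : ℝ)..x, partialSnd copulaM x t * partialFst A t y = A x y := by
    rw [← hA.integral_partialFst_Icc x y]
    refine intervalIntegral.integral_congr_ae ?_
    have : ∀ᵐ t : ℝ, t ≠ x := by simp [ae_iff]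
    filter_upwards [this] with t ht1 ht
    rw [Set.uIoc_of_le x.2.1] at ht
    rw [hM, partialFst_copulaM_of_lt ht.1 (lt_of_le_of_ne ht.2 ht1), one_mul]
  have h2 : ∫ t in (x : ℝ)..1, partialSnd copulaM x t * partialFst A t y = 0 := by
    refine intervalIntegral.integral_zero_ae ?_
    have : ∀ᵐ t : ℝ, t ≠ 1 := by simp [ae_iff]
    filter_upwards [this] with t ht1 ht
    rw [Set.uIoc_of_le x.2.2] at ht
    rw [hM, partialFst_copulaM_of_gt (lt_of_le_of_ne ht.2 ht1) ht.1, zero_mul]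
  rw [h1, h2, add_zero]

theorem starProd_copulaM (hA : IsCopula A) : _root_.starProd A copulaM = A := by
  have := hA.flip.copulaM_starProd
  rw [← flip_copulaM, starProd_flip_flip] at this
  exact congrArg _root_.flip this

theorem starProd_copulaPi (hA : IsCopula A) : _root_.starProd A copulaPi = copulaPi := by
  funext x y
  have h : _root_.starProd A copulaPi x y = ∫ t in (0 : ℝ)..1, partialSnd A x t * y := by
    refine intervalIntegral.integral_congr_ae ?_
    have : ∀ᵐ t : ℝ, t ≠ 1 := by simp [ae_iff]
    filter_upwards [this] with t ht1 ht
    rw [Set.uIoc_of_le zero_le_one] at ht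
    rw [partialFst_copulaPi ht.1 (lt_of_le_of_ne ht.2 ht1)]
  rw [h, intervalIntegral.integral_mul_const]
  have := hA.flip.integral_partialFst_Icc 1 x
  rw [hA.flip.left_one] at this
  exact congrArg (· * (y : ℝ)) this

theorem copulaPi_starProd (hA : IsCopula A) : _root_.starProd copulaPi A = copulaPi := by
  have := hA.flip.starProd_copulaPi
  rw [← flip_copulaPi, starProd_flip_flip] at this
  exact congrArg _root_.flip this

end IsCopula

/-! ### Probability integral transform and conditional expectation -/

theorem integral_map_withDensity_ofReal {Ω : Type*} [MeasurableSpace Ω] {P : Measure Ω}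
    {X g : Ω → ℝ} (hX : Measurable X) (hg : Measurable g)
    (h0 : ∀ ω, 0 ≤ g ω) {φ : ℝ → ℝ} (hφ : Measurable φ) :
    ∫ x, φ x ∂((P.withDensity fun ω => ENNReal.ofReal (g ω)).map X) =
      ∫ ω, φ (X ω) * g ω ∂P := by
  rw [integral_map hX.aemeasurable hφ.aestronglyMeasurable,
    integral_withDensity_eq_integral_toReal_smul hg.ennreal_ofReal
      (ae_of_all _ fun _ => ENNReal.ofReal_lt_top)]
  refine integral_congr_ae (ae_of_all _ fun ω => ?_)
  simp [ENNReal.toReal_ofReal (h0 ω), mul_comm]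

section

variable {Ω : Type*} [MeasurableSpace Ω] {P : Measure Ω} [IsProbabilityMeasure P]
  {X Y Z W : Ω → ℝ}

theorem IsContinuousRV.measurable_distFun (hX : IsContinuousRV P X) : Measurable (distFun P X) :=
  hX.2.measurable

theorem IsContinuousRV.measurable_coe_distFun (hX : IsContinuousRV P X) :
    Measurable fun x => (distFun P X x : ℝ) :=
  measurable_subtype_coe.comp hX.measurable_distFun

theorem IsContinuousRV.measurable_transform (hX : IsContinuousRV P X) :
    Measurable fun ω => distFun P X (X ω) :=
  hX.measurable_distFun.comp hX.1

theorem IsContinuousRV.measurableSet_transform_le (hX : IsContinuousRV P X) (u : unitInterval) :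
    MeasurableSet {ω | distFun P X (X ω) ≤ u} :=
  hX.measurable_transform measurableSet_Iic

/-- F may be constant on intervals, so the events can differ; but one contains the other and both
have probability F(x). -/
theorem IsContinuousRV.setOf_le_ae_eq (hX : IsContinuousRV P X) (x : ℝ) :
    {ω | X ω ≤ x} =ᵐ[P] {ω | distFun P X (X ω) ≤ distFun P X x} := by
  refine ae_eq_of_subset_of_measure_ge (fun ω h => distFun_mono P X h) ?_
    (hX.1 measurableSet_Iic).nullMeasurableSet (measure_ne_top _ _)
  refine (ENNReal.toReal_le_toReal (measure_ne_top _ _) (measure_ne_top _ _)).1 ?_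
  exact (prob_distFun_le P hX (distFun P X x)).le

/-- The probability integral transform, as an equality of laws. -/
theorem IsContinuousRV.map_distFun (hX : IsContinuousRV P X) :
    P.map (fun ω => (distFun P X (X ω) : ℝ)) = volume.restrict (Set.Ioc (0 : ℝ) 1) := by
  have hm : Measurable fun ω => (distFun P X (X ω) : ℝ) :=
    measurable_subtype_coe.comp hX.measurable_transform
  have := Measure.isProbabilityMeasure_map (μ := P) hm.aemeasurable
  refine Measure.ext_of_Iic _ _ fun u => ?_
  rw [Measure.map_apply hm measurableSet_Iic, Measure.restrict_apply measurableSet_Iic]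
  rcases lt_or_ge u 0 with hu | hu
  · have h1 : (fun ω => (distFun P X (X ω) : ℝ)) ⁻¹' Set.Iic u = ∅ := by
      ext ω
      simpa using hu.trans_le (distFun P X (X ω)).2.1
    have h2 : Set.Iic u ∩ Set.Ioc (0 : ℝ) 1 = ∅ := by
      ext t
      simp only [Set.mem_inter_iff, Set.mem_Iic, Set.mem_Ioc, Set.mem_empty_iff_false, iff_false]
      intro h; linarith [h.1, h.2.1]
    rw [h1, h2]; simp
  rcases le_or_gt u 1 with hu1 | hu1
  · have h1 := prob_distFun_le P hX ⟨u, hu, hu1⟩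
    have h2 : Set.Iic u ∩ Set.Ioc (0 : ℝ) 1 = Set.Ioc 0 u := by
      ext t
      simp only [Set.mem_inter_iff, Set.mem_Iic, Set.mem_Ioc]
      constructor
      · intro h; exact ⟨h.2.1, h.1⟩
      · intro h; exact ⟨h.2, h.1, h.2.trans hu1⟩
    rw [h2, Real.volume_Ioc, sub_zero, ← ofReal_measureReal]
    exact congrArg ENNReal.ofReal h1
  · have h1 : (fun ω => (distFun P X (X ω) : ℝ)) ⁻¹' Set.Iic u = Set.univ := by
      ext ω
      simpa using (distFun P X (X ω)).2.2.trans hu1.le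
    have h2 : Set.Iic u ∩ Set.Ioc (0 : ℝ) 1 = Set.Ioc 0 1 :=
      Set.inter_eq_right.2 fun t ht => ht.2.trans hu1.le
    rw [h1, h2]; simp

theorem IsContinuousRV.integral_comp_distFun (hX : IsContinuousRV P X) {f : ℝ → ℝ}
    (hf : Measurable f) :
    ∫ ω, f (distFun P X (X ω)) ∂P = ∫ t in (0 : ℝ)..1, f t := by
  have hm : Measurable fun ω => (distFun P X (X ω) : ℝ) :=
    measurable_subtype_coe.comp hX.measurable_transform
  rw [intervalIntegral.integral_of_le zero_le_one, ← hX.map_distFun,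
    integral_map hm.aemeasurable hf.aestronglyMeasurable]

theorem integrable_of_mem_Icc {h : Ω → ℝ} (hm : Measurable h) (h0 : ∀ ω, 0 ≤ h ω)
    (h1 : ∀ ω, h ω ≤ 1) : Integrable h P :=
  Integrable.of_bound hm.aestronglyMeasurable 1
    (ae_of_all _ fun ω => by rw [Real.norm_of_nonneg (h0 ω)]; exact h1 ω)

theorem map_withDensity_ofReal_Iic {g : Ω → ℝ} (hX : IsContinuousRV P X) (hg : Measurable g)
    (h0 : ∀ ω, 0 ≤ g ω) (h1 : ∀ ω, g ω ≤ 1) (x : ℝ) :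
    (P.withDensity fun ω => ENNReal.ofReal (g ω)).map X (Set.Iic x) =
      ENNReal.ofReal (∫ ω in {ω | distFun P X (X ω) ≤ distFun P X x}, g ω ∂P) := by
  rw [Measure.map_apply hX.1 measurableSet_Iic, withDensity_apply _ (hX.1 measurableSet_Iic),
    ← setIntegral_congr_set (hX.setOf_le_ae_eq x),
    ofReal_integral_eq_lintegral_ofReal (integrable_of_mem_Icc hg h0 h1).integrableOn
      (ae_of_all _ h0)]
  rfl

/-- If `u ↦ D u y` is `u ↦ E[1_{F(X) ≤ u} h]`, then its derivative at `F(X)` is a version of the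
conditional expectation of `h` given `X`. -/
theorem integral_mul_eq_integral_mul_partialFst (hX : IsContinuousRV P X)
    {D : unitInterval → unitInterval → ℝ} (hD : IsCopula D) (y : unitInterval) {h : Ω → ℝ}
    (hm : Measurable h) (h0 : ∀ ω, 0 ≤ h ω) (h1 : ∀ ω, h ω ≤ 1)
    (hH : ∀ u, D u y = ∫ ω in {ω | distFun P X (X ω) ≤ u}, h ω ∂P) {φ : ℝ → ℝ}
    (hφ : Measurable φ) :
    ∫ ω, φ (X ω) * h ω ∂P = ∫ ω, φ (X ω) * partialFst D (distFun P X (X ω)) y ∂P := by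
  have hk : Measurable fun t => partialFst D t y := hD.sepLipschitz.measurable_partialFst y
  have hkX : Measurable fun ω => partialFst D (distFun P X (X ω)) y :=
    hk.comp (measurable_subtype_coe.comp hX.measurable_transform)
  -- Both weighted laws of X give the half-line up to x the mass D(F(x),y), and finite measures
  -- agreeing on half-lines are equal. No integrability of φ is needed afterwards.
  have key : (P.withDensity fun ω => ENNReal.ofReal (h ω)).map X =
      (P.withDensity fun ω => ENNReal.ofReal (partialFst D (distFun P X (X ω)) y)).map X := by
    have := isFiniteMeasure_withDensity_ofReal
      (integrable_of_mem_Icc (P := P) hm h0 h1).2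
    refine Measure.ext_of_Iic _ _ fun x => ?_
    rw [map_withDensity_ofReal_Iic hX hm h0 h1,
      map_withDensity_ofReal_Iic hX hkX (fun _ => hD.partialFst_nonneg _ _)
        (fun _ => hD.partialFst_le_one _ _), ← hH]
    congr 1
    set u := distFun P X x
    have e : ∀ ω, {ω | distFun P X (X ω) ≤ u}.indicator
        (fun ω => partialFst D (distFun P X (X ω)) y) ω =
        (Set.Iic (u : ℝ)).indicator (fun t => partialFst D t y) (distFun P X (X ω)) := by
      intro ω
      simp only [Set.indicator]
      rfl
    rw [← integral_indicator (hX.measurableSet_transform_le u), integral_congr_ae (ae_of_all _ e),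
      hX.integral_comp_distFun (hk.indicator measurableSet_Iic),
      intervalIntegral.integral_of_le zero_le_one, setIntegral_indicator measurableSet_Iic,
      ← hD.integral_partialFst_Icc, intervalIntegral.integral_of_le u.2.1]
    congr 2
    ext t
    simp only [Set.mem_inter_iff, Set.mem_Iic, Set.mem_Ioc]
    constructor
    · intro h; exact ⟨⟨h.1, h.2.trans u.2.2⟩, h.2⟩
    · intro h; exact ⟨h.1.1, h.2⟩
  rw [← integral_map_withDensity_ofReal hX.1 hm h0 hφ, key,
    integral_map_withDensity_ofReal hX.1 hkX (fun _ => hD.partialFst_nonneg _ _) hφ]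

/-! ### Products of copulas of random variables -/

theorem flip_copulaOf : flip (copulaOf P X Y) = copulaOf P Y X := by
  funext u v
  simp only [flip, copulaOf, and_comm]

theorem isCopula_copulaOf (hX : IsContinuousRV P X) (hY : IsContinuousRV P Y) :
    IsCopula (copulaOf P X Y) :=
  (isCopulaOf_copulaOf P hX hY).1

theorem copulaOf_eq_setIntegral (hY : IsContinuousRV P Y)
    (u v : unitInterval) :
    copulaOf P X Y u v = ∫ ω in {ω | distFun P X (X ω) ≤ u},
      {ω | distFun P Y (Y ω) ≤ v}.indicator (fun _ => (1 : ℝ)) ω ∂P := by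
  rw [setIntegral_indicator (hY.measurableSet_transform_le v), setIntegral_const, smul_eq_mul,
    mul_one]
  rfl

/-- This identifies ∂₁C(F(X),v) with the conditional probability of G(Y) ≤ v given X, tested against
functions of X. -/
theorem integral_mul_indicator_transform (hX : IsContinuousRV P X) (hY : IsContinuousRV P Y)
    (v : unitInterval) {φ : ℝ → ℝ} (hφ : Measurable φ) :
    ∫ ω, φ (X ω) * {ω | distFun P Y (Y ω) ≤ v}.indicator (fun _ => (1 : ℝ)) ω ∂P =
      ∫ ω, φ (X ω) * partialFst (copulaOf P X Y) (distFun P X (X ω)) v ∂P :=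
  integral_mul_eq_integral_mul_partialFst hX (isCopula_copulaOf hX hY) v
    (measurable_const.indicator (hY.measurableSet_transform_le v))
    (fun ω => Set.indicator_nonneg (fun _ _ => zero_le_one) ω)
    (fun ω => Set.indicator_le_self' (fun _ _ => zero_le_one) ω)
    (fun u => copulaOf_eq_setIntegral hY u v) hφ

/-- If `Z` is a function of `X`, then `C_{Z,X} * C_{X,W} = C_{Z,W}`. -/
theorem CompletelyDependentOn.starProd_copulaOf (hZX : CompletelyDependentOn P Z X)
    (hX : IsContinuousRV P X) (hZ : IsContinuousRV P Z) (hW : IsContinuousRV P W) :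
    starProd (copulaOf P Z X) (copulaOf P X W) = copulaOf P Z W := by
  obtain ⟨f, hf, hfX⟩ := hZX
  funext x y
  have hk : Measurable fun t => partialFst (copulaOf P X W) t y :=
    (isCopula_copulaOf hX hW).sepLipschitz.measurable_partialFst y
  have hj : Measurable fun t => partialFst (copulaOf P X Z) t x :=
    (isCopula_copulaOf hX hZ).sepLipschitz.measurable_partialFst x
  have hE : MeasurableSet {r | distFun P Z (f r) ≤ x} :=
    (hZ.measurable_distFun.comp hf) measurableSet_Iic
  have hφ : ∀ᵐ ω ∂P, {ω | distFun P Z (Z ω) ≤ x}.indicator (fun _ => (1 : ℝ)) ω =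
      {r | distFun P Z (f r) ≤ x}.indicator (fun _ => (1 : ℝ)) (X ω) := by
    filter_upwards [hfX] with ω hω
    simp only [Set.indicator, Set.mem_ofPred_eq, hω]
  symm
  calc copulaOf P Z W x y
      = ∫ ω, {r | distFun P Z (f r) ≤ x}.indicator (fun _ => (1 : ℝ)) (X ω) *
          {ω | distFun P W (W ω) ≤ y}.indicator (fun _ => (1 : ℝ)) ω ∂P := by
        rw [copulaOf_eq_setIntegral hW,
          ← integral_indicator (hZ.measurableSet_transform_le x)]
        refine integral_congr_ae ?_
        filter_upwards [hφ] with ω hω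
        rw [← hω]
        simp only [Set.indicator]
        split_ifs <;> simp
    _ = ∫ ω, {r | distFun P Z (f r) ≤ x}.indicator (fun _ => (1 : ℝ)) (X ω) *
          partialFst (copulaOf P X W) (distFun P X (X ω)) y ∂P :=
        integral_mul_indicator_transform hX hW y (measurable_const.indicator hE)
    -- The event for W has been conditioned on X. The resulting factor is a function of X, so the
    -- event for Z can now be conditioned on X in turn.
    _ = ∫ ω, partialFst (copulaOf P X W) (distFun P X (X ω)) y *
          {ω | distFun P Z (Z ω) ≤ x}.indicator (fun _ => (1 : ℝ)) ω ∂P := by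
        refine integral_congr_ae ?_
        filter_upwards [hφ] with ω hω
        rw [← hω, mul_comm]
    _ = ∫ ω, partialFst (copulaOf P X W) (distFun P X (X ω)) y *
          partialFst (copulaOf P X Z) (distFun P X (X ω)) x ∂P :=
        integral_mul_indicator_transform hX hZ x
          (φ := fun r => partialFst (copulaOf P X W) (distFun P X r) y)
          (hk.comp hX.measurable_coe_distFun)
    _ = ∫ t in (0 : ℝ)..1, partialFst (copulaOf P X W) t y * partialFst (copulaOf P X Z) t x :=
        hX.integral_comp_distFun (hk.mul hj)
    _ = starProd (copulaOf P Z X) (copulaOf P X W) x y := by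
        rw [← flip_copulaOf (X := Z) (Y := X)]
        exact intervalIntegral.integral_congr fun t _ => mul_comm _ _

/-- Conditioning the event F(X) ≤ u on Y gives the formula. It makes the ∂₁ of the product,
evaluated at F(X), a version of E[∂₁C(G(Y),v) | X]. -/
theorem setIntegral_partialFst_transform (hX : IsContinuousRV P X) (hY : IsContinuousRV P Y)
    {C : unitInterval → unitInterval → ℝ} (hC : IsCopula C) (u v : unitInterval) :
    starProd (copulaOf P X Y) C u v = ∫ ω in {ω | distFun P X (X ω) ≤ u},
      partialFst C (distFun P Y (Y ω)) v ∂P := by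
  have hk : Measurable fun t => partialFst C t v := hC.sepLipschitz.measurable_partialFst v
  have hj : Measurable fun t => partialFst (copulaOf P Y X) t u :=
    (isCopula_copulaOf hY hX).sepLipschitz.measurable_partialFst u
  have := integral_mul_indicator_transform hY hX u
    (φ := fun r => partialFst C (distFun P Y r) v) (hk.comp hY.measurable_coe_distFun)
  rw [← integral_indicator (hX.measurableSet_transform_le u)]
  calc starProd (copulaOf P X Y) C u v
      = ∫ t in (0 : ℝ)..1, partialFst C t v * partialFst (copulaOf P Y X) t u := by
        rw [← flip_copulaOf (X := X) (Y := Y)]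
        exact intervalIntegral.integral_congr fun t _ => mul_comm _ _
    _ = _ := (hY.integral_comp_distFun (hk.mul hj)).symm
    _ = _ := this.symm
    _ = _ := by
        refine integral_congr_ae (ae_of_all _ fun ω => ?_)
        simp only [Set.indicator]
        split_ifs <;> simp

/-- The expectation on the right is symmetric under transposition, so the other bracketing of the
triple product equals it too. Associativity follows. -/
theorem starProd_starProd_copulaOf_eq_integral (hX : IsContinuousRV P X)
    (hY : IsContinuousRV P Y) {A C : unitInterval → unitInterval → ℝ} (hA : IsCopula A)
    (hC : IsCopula C) (x y : unitInterval) :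
    starProd A (starProd (copulaOf P X Y) C) x y =
      ∫ ω, partialSnd A x (distFun P X (X ω)) * partialFst C (distFun P Y (Y ω)) y ∂P := by
  have hB := isCopula_copulaOf hX hY
  have ha : Measurable fun t => partialSnd A x t := hA.flip.sepLipschitz.measurable_partialFst x
  have hk : Measurable fun t => partialFst C t y := hC.sepLipschitz.measurable_partialFst y
  have hd : Measurable fun t => partialFst (starProd (copulaOf P X Y) C) t y :=
    (hB.starProd hC).sepLipschitz.measurable_partialFst y
  rw [integral_mul_eq_integral_mul_partialFst hX (hB.starProd hC) y
    (h := fun ω => partialFst C (distFun P Y (Y ω)) y)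
    (φ := fun r => partialSnd A x (distFun P X r))
    (hk.comp (hY.measurable_coe_distFun.comp hY.1)) (fun _ => hC.partialFst_nonneg _ _)
    (fun _ => hC.partialFst_le_one _ _)
    (fun u => setIntegral_partialFst_transform hX hY hC u y)
    (ha.comp hX.measurable_coe_distFun)]
  exact (hX.integral_comp_distFun (ha.mul hd)).symm

theorem starProd_assoc_copulaOf (hX : IsContinuousRV P X) (hY : IsContinuousRV P Y)
    {A C : unitInterval → unitInterval → ℝ} (hA : IsCopula A) (hC : IsCopula C) :
    starProd (starProd A (copulaOf P X Y)) C = starProd A (starProd (copulaOf P X Y) C) := by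
  funext x y
  rw [starProd_starProd_copulaOf_eq_integral hX hY hA hC]
  have := starProd_starProd_copulaOf_eq_integral hY hX hC.flip hA.flip y x
  rw [← flip_copulaOf (X := X) (Y := Y), starProd_flip_flip, starProd_flip_flip] at this
  refine Eq.trans this (integral_congr_ae (ae_of_all _ fun ω => mul_comm _ _))

end

/-! ### Realising a copula by random variables; associativity -/

namespace IsCopula

variable {B : unitInterval → unitInterval → ℝ}

/-- The family `q ↦ ∂₁B(t, q)` of conditional distribution functions at rational points. -/
noncomputable def _root_.ratCondCDF (B : unitInterval → unitInterval → ℝ) (t : ℝ) (q : ℚ) : ℝ :=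
  partialFst B t (clampI q)

theorem measurable_ratCondCDF (hB : IsCopula B) : Measurable (ratCondCDF B) :=
  measurable_pi_lambda _ fun _ => hB.sepLipschitz.measurable_partialFst _

/-- Monotonicity gives one inequality almost everywhere. Both sides have the same integral, because
∂₁B(·,y) integrates to y and y ↦ y is continuous; hence they agree almost everywhere. -/
theorem ratCondCDF_right_continuous_ae (hB : IsCopula B) (q : ℚ) :
    ∀ᵐ t ∂volume.restrict (Set.Ioc (0 : ℝ) 1),
      ⨅ r : Set.Ioi q, ratCondCDF B t r = ratCondCDF B t q := by
  have hmono : ∀ᵐ t : ℝ, Monotone (ratCondCDF B t) := by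
    have : ∀ᵐ t : ℝ, ∀ a b : ℚ, a ≤ b → ratCondCDF B t a ≤ ratCondCDF B t b := by
      simp only [ae_all_iff]
      intro a b hab
      exact hB.partialFst_mono_ae (clampI_mono (by exact_mod_cast hab))
    filter_upwards [this] with t ht a b hab using ht a b hab
  have hbdd : ∀ t, BddBelow (Set.range fun r : Set.Ioi q => ratCondCDF B t r) := fun t =>
    ⟨0, by rintro _ ⟨r, rfl⟩; exact hB.partialFst_nonneg _ _⟩
  have hne : Nonempty (Set.Ioi q) := ⟨⟨q + 1, by simp⟩⟩
  have hm : Measurable fun t => ⨅ r : Set.Ioi q, ratCondCDF B t r :=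
    .iInf fun r => hB.sepLipschitz.measurable_partialFst _
  have h0 : ∀ t, 0 ≤ ⨅ r : Set.Ioi q, ratCondCDF B t r := fun t =>
    le_ciInf fun r => hB.partialFst_nonneg _ _
  have h1 : ∀ t, ⨅ r : Set.Ioi q, ratCondCDF B t r ≤ 1 := fun t =>
    (ciInf_le (hbdd t) ⟨q + 1, by simp⟩).trans (hB.partialFst_le_one _ _)
  have i1 : Integrable (fun t => ⨅ r : Set.Ioi q, ratCondCDF B t r)
      (volume.restrict (Set.Ioc (0 : ℝ) 1)) :=
    Integrable.of_bound hm.aestronglyMeasurable 1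
      (ae_of_all _ fun t => by rw [Real.norm_of_nonneg (h0 t)]; exact h1 t)
  have i2 : ∀ y : unitInterval, Integrable (fun t => partialFst B t y)
      (volume.restrict (Set.Ioc (0 : ℝ) 1)) := fun y =>
    (hB.sepLipschitz.intervalIntegrable_partialFst y 0 1).1
  have e2 : ∀ y : unitInterval, ∫ t in Set.Ioc (0 : ℝ) 1, partialFst B t y = y := fun y => by
    rw [← hB.left_one y, ← hB.integral_partialFst_Icc 1 y]
    exact (intervalIntegral.integral_of_le zero_le_one).symm
  have hle : (fun t => ratCondCDF B t q) ≤ᵐ[volume.restrict (Set.Ioc (0 : ℝ) 1)]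
      fun t => ⨅ r : Set.Ioi q, ratCondCDF B t r := by
    filter_upwards [ae_restrict_of_ae hmono] with t ht
    exact le_ciInf fun r => ht (le_of_lt r.2)
  have hint : ∫ t in Set.Ioc (0 : ℝ) 1, ratCondCDF B t q =
      ∫ t in Set.Ioc (0 : ℝ) 1, ⨅ r : Set.Ioi q, ratCondCDF B t r := by
    refine le_antisymm (integral_mono_ae (i2 _) i1 hle) ?_
    have hup : ∀ r : ℚ, q < r →
        ∫ t in Set.Ioc (0 : ℝ) 1, ⨅ r : Set.Ioi q, ratCondCDF B t r ≤ clampI r := by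
      intro r hr
      rw [← e2]
      exact integral_mono i1 (i2 _) fun t => ciInf_le (hbdd t) ⟨r, hr⟩
    refine le_trans ?_ (e2 (clampI q)).ge
    have hlim : Tendsto (fun n : ℕ => ((clampI ((q : ℝ) + 1 / ((n : ℝ) + 1)) : unitInterval) : ℝ))
        atTop (𝓝 (clampI q)) := by
      have : Tendsto (fun n : ℕ => (q : ℝ) + 1 / ((n : ℝ) + 1)) atTop (𝓝 ((q : ℝ) + 0)) :=
        tendsto_const_nhds.add tendsto_one_div_add_atTop_nhds_zero_nat
      rw [add_zero] at this
      exact ((continuous_subtype_val.comp continuous_clampI).tendsto _).comp this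
    refine ge_of_tendsto' hlim fun n => ?_
    have := hup (q + 1 / ((n : ℚ) + 1)) (by simp; positivity)
    simpa using this
  have := (integral_eq_iff_of_ae_le (i2 (clampI q)) i1 hle).1 hint
  filter_upwards [this] with t ht using ht.symm

theorem isRatStieltjesPoint_ae (hB : IsCopula B) :
    ∀ᵐ t ∂volume.restrict (Set.Ioc (0 : ℝ) 1), IsRatStieltjesPoint (ratCondCDF B) t := by
  have hmono : ∀ᵐ t : ℝ, ∀ a b : ℚ, a ≤ b → ratCondCDF B t a ≤ ratCondCDF B t b := by
    simp only [ae_all_iff]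
    intro a b hab
    exact hB.partialFst_mono_ae (clampI_mono (by exact_mod_cast hab))
  have h1 : ∀ᵐ t : ℝ, t ≠ 1 := by simp [ae_iff]
  filter_upwards [ae_restrict_of_ae hmono, ae_restrict_of_ae h1,
    ae_restrict_mem measurableSet_Ioc, ae_all_iff.2 hB.ratCondCDF_right_continuous_ae]
    with t hm ht1 ht hr
  refine ⟨fun a b => hm a b, ?_, ?_, hr⟩
  · refine tendsto_const_nhds.congr' ?_
    filter_upwards [eventually_ge_atTop 1] with q hq
    have : clampI q = 1 := Set.projIcc_of_right_le _ (by exact_mod_cast hq)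
    rw [ratCondCDF, this, hB.partialFst_one ht.1 (lt_of_le_of_ne ht.2 ht1)]
  · refine tendsto_const_nhds.congr' ?_
    filter_upwards [eventually_le_atBot 0] with q hq
    have : clampI q = 0 := Set.projIcc_of_le_left _ (by exact_mod_cast hq)
    rw [ratCondCDF, this, hB.partialFst_zero]

/-- The conditional law of the second coordinate given the first one, for the doubly stochastic
measure with distribution function `B`. -/
noncomputable def condKernelOf (hB : IsCopula B) : Kernel ℝ ℝ where
  toFun t := (stieltjesOfMeasurableRat (ratCondCDF B) hB.measurable_ratCondCDF t).measure
  measurable' := measurable_measure_stieltjesOfMeasurableRat _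

instance (hB : IsCopula B) : IsMarkovKernel hB.condKernelOf :=
  ⟨fun t => instIsProbabilityMeasure_stieltjesOfMeasurableRat _ t⟩

theorem condKernelOf_Iic_rat_ae (hB : IsCopula B) (q : ℚ) :
    ∀ᵐ t ∂volume.restrict (Set.Ioc (0 : ℝ) 1),
      hB.condKernelOf t (Set.Iic q) = ENNReal.ofReal (partialFst B t (clampI q)) := by
  filter_upwards [hB.isRatStieltjesPoint_ae] with t ht
  refine (measure_stieltjesOfMeasurableRat_Iic _ t _).trans ?_
  rw [stieltjesOfMeasurableRat_eq, toRatCDF_of_isRatStieltjesPoint ht]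
  rfl

instance : IsProbabilityMeasure (volume.restrict (Set.Ioc (0 : ℝ) 1)) := ⟨by simp⟩

/-- The doubly stochastic measure with distribution function `B`. -/
noncomputable def jointLaw (hB : IsCopula B) : Measure (ℝ × ℝ) :=
  (volume.restrict (Set.Ioc (0 : ℝ) 1)).compProd hB.condKernelOf

instance (hB : IsCopula B) : IsProbabilityMeasure hB.jointLaw := by
  unfold jointLaw; infer_instance

theorem jointLaw_real_rat (hB : IsCopula B) (x : ℝ) (q : ℚ) :
    hB.jointLaw.real {ω | ω.1 ≤ x ∧ ω.2 ≤ q} = B (clampI x) (clampI q) := by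
  have hs : {ω : ℝ × ℝ | ω.1 ≤ x ∧ ω.2 ≤ q} = Set.Iic x ×ˢ Set.Iic (q : ℝ) := rfl
  have hcl : ((clampI x : unitInterval) : ℝ) = max 0 (min 1 x) := Set.coe_projIcc _ _ _ x
  have hset : Set.Iic x ∩ Set.Ioc (0 : ℝ) 1 = Set.Ioc 0 (clampI x : ℝ) := by
    ext t
    simp only [Set.mem_inter_iff, Set.mem_Iic, Set.mem_Ioc, hcl]
    constructor
    · intro h; exact ⟨h.2.1, le_max_of_le_right (le_min h.2.2 h.1)⟩
    · intro h
      have := (le_max_iff.1 h.2).resolve_left (not_le.2 h.1)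
      exact ⟨this.trans (min_le_right _ _), h.1, this.trans (min_le_left _ _)⟩
  have hsub : Set.Ioc 0 (clampI x : ℝ) ⊆ Set.Ioc (0 : ℝ) 1 :=
    Set.Ioc_subset_Ioc_right (clampI x).2.2
  have hae : ∀ᵐ t ∂volume.restrict (Set.Ioc 0 (clampI x : ℝ)),
      hB.condKernelOf t (Set.Iic q) = ENNReal.ofReal (partialFst B t (clampI q)) :=
    ae_restrict_of_ae_restrict_of_subset hsub (hB.condKernelOf_Iic_rat_ae q)
  rw [hs, Measure.real, jointLaw, Measure.compProd_apply_prod measurableSet_Iic measurableSet_Iic,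
    Measure.restrict_restrict measurableSet_Iic, hset, lintegral_congr_ae hae,
    ← ofReal_integral_eq_lintegral_ofReal
      (hB.sepLipschitz.intervalIntegrable_partialFst _ 0 (clampI x)).1
      (ae_of_all _ fun t => hB.partialFst_nonneg _ _),
    ENNReal.toReal_ofReal (integral_nonneg fun t => hB.partialFst_nonneg _ _),
    ← intervalIntegral.integral_of_le (clampI x).2.1, hB.integral_partialFst_Icc]

/-- Rational y suffice: the left side is monotone in y and the right side continuous. -/
theorem jointLaw_real (hB : IsCopula B) (x y : ℝ) :
    hB.jointLaw.real {ω | ω.1 ≤ x ∧ ω.2 ≤ y} = B (clampI x) (clampI y) := by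
  have hc : Continuous fun y => B (clampI x) (clampI y) :=
    (hB.sepLipschitz.right _).continuous.comp continuous_clampI
  have hm : ∀ y z, y ≤ z → hB.jointLaw.real {ω | ω.1 ≤ x ∧ ω.2 ≤ y} ≤
      hB.jointLaw.real {ω | ω.1 ≤ x ∧ ω.2 ≤ z} := fun y z h =>
    measureReal_mono fun ω hω => ⟨hω.1, hω.2.trans h⟩
  have hdense : ∀ s : Set ℝ, s.Nonempty → IsOpen s → ∃ q : ℚ, (q : ℝ) ∈ s := fun s hs ho =>
    Rat.isDenseEmbedding_coe_real.dense.exists_mem_open ho hs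
  refine le_antisymm (le_of_forall_pos_lt_add fun ε hε => ?_)
    (le_of_forall_pos_lt_add fun ε hε => ?_)
  · have hev := (hc.tendsto y).eventually (gt_mem_nhds (lt_add_of_pos_right _ hε))
    obtain ⟨b, hb, hb'⟩ := (mem_nhdsGE_iff_exists_Ico_subset).1
      (nhdsWithin_le_nhds (s := Set.Ici y) hev)
    obtain ⟨q, hq⟩ := hdense (Set.Ioo y b) (Set.nonempty_Ioo.2 hb) isOpen_Ioo
    refine (hm y q hq.1.le).trans_lt ?_
    rw [hB.jointLaw_real_rat]
    exact hb' ⟨hq.1.le, hq.2⟩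
  · have hev := (hc.tendsto y).eventually (lt_mem_nhds (sub_lt_self _ hε))
    obtain ⟨b, hb, hb'⟩ := (mem_nhdsLE_iff_exists_Ioc_subset).1
      (nhdsWithin_le_nhds (s := Set.Iic y) hev)
    obtain ⟨q, hq⟩ := hdense (Set.Ioo b y) (Set.nonempty_Ioo.2 hb) isOpen_Ioo
    have h1 := hm q y hq.2.le
    rw [hB.jointLaw_real_rat] at h1
    have h2 : B (clampI x) (clampI y) - ε < B (clampI x) (clampI q) := hb' ⟨hq.1, hq.2.le⟩
    linarith

theorem ae_jointLaw_le_one (hB : IsCopula B) : ∀ᵐ ω ∂hB.jointLaw, ω.1 ≤ 1 ∧ ω.2 ≤ 1 := by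
  have h := hB.jointLaw_real 1 1
  rw [clampI_one, hB.left_one] at h
  have hm : MeasurableSet {ω : ℝ × ℝ | ω.1 ≤ 1 ∧ ω.2 ≤ 1} :=
    (measurable_fst measurableSet_Iic).inter (measurable_snd measurableSet_Iic)
  refine (prob_compl_eq_zero_iff hm).2 ?_
  rw [← ofReal_measureReal, h]
  simp

theorem distFun_jointLaw_snd (hB : IsCopula B) (y : ℝ) :
    distFun hB.jointLaw Prod.snd y = clampI y := by
  refine Subtype.ext ?_
  have h := hB.jointLaw_real 1 y
  rw [clampI_one, hB.left_one] at h
  rw [← h]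
  refine measureReal_congr ?_
  filter_upwards [hB.ae_jointLaw_le_one] with ω hω
  exact propext ⟨fun h => ⟨hω.1, h⟩, fun h => h.2⟩

theorem distFun_jointLaw_fst (hB : IsCopula B) (x : ℝ) :
    distFun hB.jointLaw Prod.fst x = clampI x := by
  refine Subtype.ext ?_
  have h := hB.jointLaw_real x 1
  rw [clampI_one, hB.right_one] at h
  rw [← h]
  refine measureReal_congr ?_
  filter_upwards [hB.ae_jointLaw_le_one] with ω hω
  exact propext ⟨fun h => ⟨h, hω.2⟩, fun h => h.1⟩

/-- Every copula is the copula of two continuous random variables. -/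
theorem exists_eq_copulaOf (hB : IsCopula B) :
    IsContinuousRV hB.jointLaw Prod.fst ∧ IsContinuousRV hB.jointLaw Prod.snd ∧
      B = copulaOf hB.jointLaw Prod.fst Prod.snd := by
  have h1 : IsContinuousRV hB.jointLaw Prod.fst :=
    ⟨measurable_fst, by simpa only [funext hB.distFun_jointLaw_fst] using continuous_clampI⟩
  have h2 : IsContinuousRV hB.jointLaw Prod.snd :=
    ⟨measurable_snd, by simpa only [funext hB.distFun_jointLaw_snd] using continuous_clampI⟩
  refine ⟨h1, h2, IsCopulaOf.eq_copulaOf h1 h2 ⟨hB, fun x y => ?_⟩⟩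
  rw [hB.jointLaw_real, hB.distFun_jointLaw_fst, hB.distFun_jointLaw_snd]

/-- Only the middle factor has to be realised by random variables. -/
theorem starProd_assoc {A C : unitInterval → unitInterval → ℝ} (hA : IsCopula A)
    (hB : IsCopula B) (hC : IsCopula C) :
    _root_.starProd (_root_.starProd A B) C = _root_.starProd A (_root_.starProd B C) := by
  obtain ⟨h1, h2, h3⟩ := hB.exists_eq_copulaOf
  rw [h3]
  exact starProd_assoc_copulaOf h1 h2 hA hC

end IsCopula

/-! ### Energies and the Sobolev norm -/

/-- The energy `∫₀¹ ∫₀¹ (∂₁A(x,y))² dx dy`. -/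
noncomputable def energyFst (A : unitInterval → unitInterval → ℝ) : ℝ :=
  ∫ y in (0 : ℝ)..1, ∫ x in (0 : ℝ)..1, (partialFst A x (clampI y)) ^ 2

/-- This turns energies into diagonal values of a product, where the algebra of `*` computes them.
-/
theorem starProd_flip_self (A : unitInterval → unitInterval → ℝ) (y : unitInterval) :
    starProd (flip A) A y y = ∫ t in (0 : ℝ)..1, (partialFst A t y) ^ 2 :=
  intervalIntegral.integral_congr fun t _ => (sq (partialFst A t y)).symm

theorem energyFst_eq (A : unitInterval → unitInterval → ℝ) :
    energyFst A = ∫ y in (0 : ℝ)..1, starProd (flip A) A (clampI y) (clampI y) := by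
  simp only [energyFst, starProd_flip_self]

theorem starProd_flip_self_nonneg (A : unitInterval → unitInterval → ℝ) (y : unitInterval) :
    0 ≤ starProd (flip A) A y y := by
  rw [starProd_flip_self]
  exact intervalIntegral.integral_nonneg zero_le_one fun t _ => sq_nonneg _

theorem energyFst_nonneg (A : unitInterval → unitInterval → ℝ) : 0 ≤ energyFst A := by
  rw [energyFst_eq]
  exact intervalIntegral.integral_nonneg zero_le_one fun t _ => starProd_flip_self_nonneg A _

/-- The gradient of `A`, with values in `ℂ` as a model of the Euclidean plane. -/
noncomputable def complexGradient (A : unitInterval → unitInterval → ℝ) (p : ℝ × ℝ) : ℂ :=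
  ⟨partialFst A p.1 (clampI p.2), partialSnd A (clampI p.1) p.2⟩

namespace SepLipschitz

variable {K K' : ℝ≥0} {A B : unitInterval → unitInterval → ℝ}

theorem measurable_partialFst_clampI (h : SepLipschitz K A) :
    Measurable fun p : ℝ × ℝ => partialFst A p.1 (clampI p.2) :=
  h.measurable_partialFst_uncurry.comp
    (measurable_fst.prodMk (continuous_clampI.measurable.comp measurable_snd))

theorem measurable_partialSnd_clampI (h : SepLipschitz K A) :
    Measurable fun p : ℝ × ℝ => partialSnd A (clampI p.1) p.2 :=
  h.flip.measurable_partialFst_clampI.comp measurable_swap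

theorem integrable_sq_partialFst (h : SepLipschitz K A) :
    Integrable (fun p : ℝ × ℝ => (partialFst A p.1 (clampI p.2)) ^ 2)
      ((volume.restrict (Set.Ioc (0 : ℝ) 1)).prod (volume.restrict (Set.Ioc (0 : ℝ) 1))) :=
  Integrable.of_bound (h.measurable_partialFst_clampI.pow_const 2).aestronglyMeasurable
    ((K : ℝ) ^ 2) (ae_of_all _ fun p => by
      rw [norm_pow]
      exact pow_le_pow_left₀ (norm_nonneg _) (h.abs_partialFst_le _ _) 2)

theorem integrable_sq_partialSnd (h : SepLipschitz K A) :
    Integrable (fun p : ℝ × ℝ => (partialSnd A (clampI p.1) p.2) ^ 2)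
      ((volume.restrict (Set.Ioc (0 : ℝ) 1)).prod (volume.restrict (Set.Ioc (0 : ℝ) 1))) :=
  Integrable.of_bound (h.measurable_partialSnd_clampI.pow_const 2).aestronglyMeasurable
    ((K : ℝ) ^ 2) (ae_of_all _ fun p => by
      rw [norm_pow]
      exact pow_le_pow_left₀ (norm_nonneg _) (h.flip.abs_partialFst_le _ _) 2)

theorem sobolevNorm_eq_sqrt_integral_prod (h : SepLipschitz K A) :
    sobolevNorm A = Real.sqrt (∫ p : ℝ × ℝ,
      ((partialFst A p.1 (clampI p.2)) ^ 2 + (partialSnd A (clampI p.1) p.2) ^ 2)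
      ∂((volume.restrict (Set.Ioc (0 : ℝ) 1)).prod (volume.restrict (Set.Ioc (0 : ℝ) 1)))) := by
  have hp := integral_prod _ (h.integrable_sq_partialFst.add h.integrable_sq_partialSnd)
  simp only [Pi.add_apply] at hp
  rw [sobolevNorm, hp]
  simp only [intervalIntegral.integral_of_le (zero_le_one (α := ℝ))]

theorem sobolevNorm_eq (h : SepLipschitz K A) :
    sobolevNorm A = Real.sqrt (energyFst A + energyFst (_root_.flip A)) := by
  rw [h.sobolevNorm_eq_sqrt_integral_prod,
    integral_add h.integrable_sq_partialFst h.integrable_sq_partialSnd,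
    integral_prod_symm _ h.integrable_sq_partialFst, integral_prod _ h.integrable_sq_partialSnd]
  simp only [energyFst, intervalIntegral.integral_of_le (zero_le_one (α := ℝ))]
  rfl

theorem sobolevNorm_flip (h : SepLipschitz K A) : sobolevNorm (_root_.flip A) = sobolevNorm A := by
  rw [h.sobolevNorm_eq, h.flip.sobolevNorm_eq, add_comm]
  rfl

theorem measurable_complexGradient (h : SepLipschitz K A) : Measurable (complexGradient A) :=
  Complex.measurableEquivRealProd.symm.measurable.comp
    (h.measurable_partialFst_clampI.prodMk h.measurable_partialSnd_clampI)

theorem norm_complexGradient_sq (A : unitInterval → unitInterval → ℝ) (p : ℝ × ℝ) :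
    ‖complexGradient A p‖ ^ 2 =
      (partialFst A p.1 (clampI p.2)) ^ 2 + (partialSnd A (clampI p.1) p.2) ^ 2 := by
  rw [← Complex.normSq_eq_norm_sq, Complex.normSq_apply]
  simp only [complexGradient, sq]

theorem memLp_complexGradient (h : SepLipschitz K A) :
    MemLp (complexGradient A) 2
      ((volume.restrict (Set.Ioc (0 : ℝ) 1)).prod (volume.restrict (Set.Ioc (0 : ℝ) 1))) := by
  rw [memLp_two_iff_integrable_sq_norm h.measurable_complexGradient.aestronglyMeasurable]
  simp only [norm_complexGradient_sq]
  exact h.integrable_sq_partialFst.add h.integrable_sq_partialSnd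

theorem sobolevNorm_eq_eLpNorm (h : SepLipschitz K A) :
    sobolevNorm A = (eLpNorm (complexGradient A) 2
      ((volume.restrict (Set.Ioc (0 : ℝ) 1)).prod
        (volume.restrict (Set.Ioc (0 : ℝ) 1)))).toReal := by
  rw [h.sobolevNorm_eq_sqrt_integral_prod,
    h.memLp_complexGradient.eLpNorm_eq_integral_rpow_norm two_ne_zero ENNReal.ofNat_ne_top,
    ENNReal.toReal_ofReal (by positivity), Real.sqrt_eq_rpow]
  simp only [ENNReal.toReal_ofNat, Real.rpow_ofNat, norm_complexGradient_sq, one_div]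

theorem complexGradient_sub_ae (h : SepLipschitz K A) (h' : SepLipschitz K' B) :
    complexGradient (A - B) =ᵐ[(volume.restrict (Set.Ioc (0 : ℝ) 1)).prod
      (volume.restrict (Set.Ioc (0 : ℝ) 1))] complexGradient A - complexGradient B := by
  have hm1 := measurableSet_eq_fun (h.sub h').measurable_partialFst_clampI
    (h.measurable_partialFst_clampI.sub h'.measurable_partialFst_clampI)
  have hm2 := measurableSet_eq_fun (h.sub h').measurable_partialSnd_clampI
    (h.measurable_partialSnd_clampI.sub h'.measurable_partialSnd_clampI)
  have h0 : ∀ᵐ y ∂volume.restrict (Set.Ioc (0 : ℝ) 1), ∀ᵐ x ∂volume.restrict (Set.Ioc (0 : ℝ) 1),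
      partialFst (A - B) x (clampI y) = partialFst A x (clampI y) - partialFst B x (clampI y) :=
    ae_of_all _ fun y => ae_restrict_of_ae (h.partialFst_sub_ae h' (clampI y))
  have h1 := (Measure.ae_prod_iff_ae_ae hm1).2 ((Measure.ae_ae_comm hm1).2 h0)
  have h2 := (Measure.ae_prod_iff_ae_ae (μ := volume.restrict (Set.Ioc (0 : ℝ) 1))
    (ν := volume.restrict (Set.Ioc (0 : ℝ) 1)) hm2).2 (ae_of_all _ fun x =>
      ae_restrict_of_ae (h.flip.partialFst_sub_ae h'.flip (clampI x)))
  filter_upwards [h1, h2] with p hp1 hp2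
  exact Complex.ext hp1 hp2

/-- Minkowski's inequality in L² for the gradient, which is additive almost everywhere. -/
theorem sobolevNorm_le_add (h : SepLipschitz K A) (h' : SepLipschitz K' B) :
    sobolevNorm A ≤ sobolevNorm (A - B) + sobolevNorm B := by
  have hs := (h.sub h').memLp_complexGradient
  rw [h.sobolevNorm_eq_eLpNorm, h'.sobolevNorm_eq_eLpNorm, (h.sub h').sobolevNorm_eq_eLpNorm,
    ← ENNReal.toReal_add hs.eLpNorm_ne_top h'.memLp_complexGradient.eLpNorm_ne_top]
  refine ENNReal.toReal_mono (ENNReal.add_ne_top.2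
    ⟨hs.eLpNorm_ne_top, h'.memLp_complexGradient.eLpNorm_ne_top⟩) ?_
  have : complexGradient A =ᵐ[(volume.restrict (Set.Ioc (0 : ℝ) 1)).prod
      (volume.restrict (Set.Ioc (0 : ℝ) 1))] complexGradient (A - B) + complexGradient B := by
    filter_upwards [h.complexGradient_sub_ae h'] with p hp
    simp only [Pi.add_apply, hp, Pi.sub_apply, sub_add_cancel]
  rw [eLpNorm_congr_ae this]
  exact eLpNorm_add_le hs.1 h'.memLp_complexGradient.1 one_le_two

end SepLipschitz

theorem partialFst_neg (A : unitInterval → unitInterval → ℝ) (t : ℝ) (y : unitInterval) :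
    partialFst (-A) t y = -partialFst A t y :=
  deriv.fun_neg

theorem sobolevNorm_neg (A : unitInterval → unitInterval → ℝ) :
    sobolevNorm (-A) = sobolevNorm A := by
  have h (x : unitInterval) (t : ℝ) : partialSnd (-A) x t = -partialSnd A x t :=
    partialFst_neg (flip A) t x
  simp only [sobolevNorm, partialFst_neg, h, neg_sq]

theorem sobolevNorm_sub_comm (A B : unitInterval → unitInterval → ℝ) :
    sobolevNorm (A - B) = sobolevNorm (B - A) := by
  rw [← sobolevNorm_neg, neg_sub]

theorem sobolevNorm_nonneg (A : unitInterval → unitInterval → ℝ) : 0 ≤ sobolevNorm A :=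
  Real.sqrt_nonneg _

/-! ### Energy of a copula minus Π -/

namespace IsCopula

variable {C D : unitInterval → unitInterval → ℝ}

theorem starProd_flip_sub_copulaPi (hD : IsCopula D) :
    _root_.starProd (_root_.flip (D - copulaPi)) (D - copulaPi) =
      _root_.starProd (_root_.flip D) D - copulaPi := by
  have hp := isCopula_copulaPi
  have e : _root_.flip (D - copulaPi) = _root_.flip D - copulaPi := by
    conv_rhs => rw [← flip_copulaPi]
    rfl
  rw [e, starProd_sub_left (hD.sepLipschitz.sub hp.sepLipschitz) hD.flip.sepLipschitz
    hp.sepLipschitz, starProd_sub_right hD.flip.sepLipschitz hD.sepLipschitz hp.sepLipschitz,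
    starProd_sub_right hp.sepLipschitz hD.sepLipschitz hp.sepLipschitz,
    hD.flip.starProd_copulaPi, hD.copulaPi_starProd, hp.copulaPi_starProd, sub_self, sub_zero]

theorem energyFst_sub_copulaPi_eq (hD : IsCopula D) :
    energyFst (D - copulaPi) = ∫ y in (0 : ℝ)..1,
      (_root_.starProd (_root_.flip D) D (clampI y) (clampI y) - y ^ 2) := by
  rw [energyFst_eq, hD.starProd_flip_sub_copulaPi]
  refine intervalIntegral.integral_congr fun y hy => ?_
  rw [Set.uIcc_of_le zero_le_one] at hy
  simp only [Pi.sub_apply, copulaPi, coe_clampI hy.1 hy.2, sq]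

theorem continuous_diagonal (hD : IsCopula D) :
    Continuous fun y => D (clampI y) (clampI y) :=
  hD.sepLipschitz.continuous_uncurry.comp (continuous_clampI.prodMk continuous_clampI)

theorem le_right (hD : IsCopula D) (x y : unitInterval) : D x y ≤ y := by
  rw [← hD.left_one y]
  exact hD.mono_left y x.2.2

/-- The diagonal of the copula Dᵀ * D lies below y, and y - y² integrates to 1/6. -/
theorem energyFst_sub_copulaPi_le (hD : IsCopula D) : energyFst (D - copulaPi) ≤ 1 / 6 := by
  have h1 : ∫ y in (0 : ℝ)..1, (y - y ^ 2) = 1 / 6 := by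
    rw [intervalIntegral.integral_sub (by simp) (by simp), integral_id, integral_pow]
    norm_num
  rw [hD.energyFst_sub_copulaPi_eq, ← h1]
  have hc := (hD.flip.starProd hD).continuous_diagonal
  refine intervalIntegral.integral_mono_on zero_le_one
    (Continuous.intervalIntegrable (by fun_prop) _ _)
    (Continuous.intervalIntegrable (by fun_prop) _ _) fun y hy => ?_
  have := (hD.flip.starProd hD).le_right (clampI y) (clampI y)
  rw [coe_clampI hy.1 hy.2] at this
  linarith

theorem sobolevNorm_sub_copulaPi_le (hD : IsCopula D) :
    sobolevNorm (D - copulaPi) ≤ Real.sqrt (1 / 3) := by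
  rw [(hD.sepLipschitz.sub isCopula_copulaPi.sepLipschitz).sobolevNorm_eq]
  refine Real.sqrt_le_sqrt ?_
  have h1 := hD.energyFst_sub_copulaPi_le
  have h2 : energyFst (_root_.flip (D - copulaPi)) ≤ 1 / 6 := by
    have := hD.flip.energyFst_sub_copulaPi_le
    rwa [← flip_copulaPi] at this
  linarith

theorem energyFst_sub_copulaPi_of_starProd_eq (hD : IsCopula D)
    (h : _root_.starProd (_root_.flip D) D = copulaM) : energyFst (D - copulaPi) = 1 / 6 := by
  have h1 : ∫ y in (0 : ℝ)..1, (y - y ^ 2) = 1 / 6 := by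
    rw [intervalIntegral.integral_sub (by simp) (by simp), integral_id, integral_pow]
    norm_num
  rw [hD.energyFst_sub_copulaPi_eq, h, ← h1]
  refine intervalIntegral.integral_congr fun y hy => ?_
  rw [Set.uIcc_of_le zero_le_one] at hy
  simp only [copulaM, coe_clampI hy.1 hy.2, min_self]

/-- A copula that agrees with `M` far below the diagonal has almost maximal energy. -/
theorem le_energyFst_flip_sub_copulaPi (hD : IsCopula D) {ε : ℝ} (hε : 0 ≤ ε)
    (h : ∀ u v : unitInterval, (v : ℝ) + ε ≤ u → D u v = v) :
    1 / 6 - ε ≤ energyFst (_root_.flip (D - copulaPi)) := by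
  have e : _root_.flip (D - copulaPi) = _root_.flip D - copulaPi := by
    conv_rhs => rw [← flip_copulaPi]
    rfl
  have h1 : ∫ y in (0 : ℝ)..1, (y - ε - y ^ 2) = 1 / 6 - ε := by
    rw [intervalIntegral.integral_sub (by simp) (by simp),
      intervalIntegral.integral_sub (by simp) (by simp), integral_id, integral_pow]
    norm_num
    ring
  rw [e, hD.flip.energyFst_sub_copulaPi_eq, ← h1]
  have hc := (hD.flip.flip.starProd hD.flip).continuous_diagonal
  refine intervalIntegral.integral_mono_on zero_le_one
    (Continuous.intervalIntegrable (by fun_prop) _ _)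
    (Continuous.intervalIntegrable (by fun_prop) _ _) fun x hx => ?_
  have hx' := coe_clampI hx.1 hx.2
  rw [starProd_flip_self]
  suffices x - ε ≤ ∫ t in (0 : ℝ)..1, (partialFst (_root_.flip D) t (clampI x)) ^ 2 by linarith
  rcases le_total (x - ε) 0 with hneg | hpos
  · exact hneg.trans (intervalIntegral.integral_nonneg zero_le_one fun t _ => sq_nonneg _)
  have hle1 : x - ε ≤ 1 := by linarith [hx.2]
  have hi : ∀ a b, IntervalIntegrable
      (fun t => (partialFst (_root_.flip D) t (clampI x)) ^ 2) volume a b :=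
    intervalIntegrable_of_abs_le (K := 1 ^ 2)
      ((hD.flip.sepLipschitz.measurable_partialFst _).pow_const 2) fun t => by
        rw [abs_pow]
        exact pow_le_pow_left₀ (abs_nonneg _) (hD.flip.sepLipschitz.abs_partialFst_le _ _) 2
  rw [← intervalIntegral.integral_add_adjacent_intervals (hi 0 (x - ε)) (hi (x - ε) 1)]
  -- For t < x - ε the hypothesis gives D(x,s) = s for s near t, so the derivative is 1. The rest of
  -- the interval only adds to the integral.
  have h2 : ∫ t in (0 : ℝ)..(x - ε), (partialFst (_root_.flip D) t (clampI x)) ^ 2 =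
      ∫ t in (0 : ℝ)..(x - ε), (1 : ℝ) := by
    refine intervalIntegral.integral_congr_ae ?_
    have : ∀ᵐ t : ℝ, t ≠ x - ε := by simp [ae_iff]
    filter_upwards [this] with t ht1 ht
    rw [Set.uIoc_of_le hpos] at ht
    have hev : (fun s : ℝ => _root_.flip D (clampI s) (clampI x)) =ᶠ[𝓝 t] fun s => s := by
      filter_upwards [Ioo_mem_nhds ht.1 (lt_of_le_of_ne ht.2 ht1)] with s hs
      have hs' := coe_clampI hs.1.le (hs.2.le.trans hle1)
      rw [_root_.flip, h _ _ (by rw [hx', hs']; linarith [hs.2]), hs']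
    rw [partialFst, hev.deriv_eq, deriv_id'', one_pow]
  have h3 : 0 ≤ ∫ t in (x - ε)..1, (partialFst (_root_.flip D) t (clampI x)) ^ 2 :=
    intervalIntegral.integral_nonneg hle1 fun t _ => sq_nonneg _
  rw [h2, intervalIntegral.integral_const, smul_eq_mul, mul_one]
  linarith

/-- The inner integral of (∂₁(C - Π))² is a diagonal value of a difference of copulas, hence
continuous in y. It therefore vanishes for every y, not just almost every y, and integrating ∂₁(C -
Π) from 0 gives C = Π. -/
theorem eq_copulaPi_of_sobolevNorm_eq_zero (hC : IsCopula C)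
    (h : sobolevNorm (C - copulaPi) = 0) : C = copulaPi := by
  have hL := hC.sepLipschitz.sub isCopula_copulaPi.sepLipschitz
  rw [hL.sobolevNorm_eq, Real.sqrt_eq_zero (add_nonneg (energyFst_nonneg _) (energyFst_nonneg _))]
    at h
  have hE : energyFst (C - copulaPi) = 0 :=
    le_antisymm (by linarith [energyFst_nonneg (_root_.flip (C - copulaPi))]) (energyFst_nonneg _)
  have hc : Continuous fun y : ℝ =>
      _root_.starProd (_root_.flip (C - copulaPi)) (C - copulaPi) (clampI y) (clampI y) := by
    rw [hC.starProd_flip_sub_copulaPi]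
    exact (hC.flip.starProd hC).continuous_diagonal.sub isCopula_copulaPi.continuous_diagonal
  have hz : ∀ y : unitInterval,
      _root_.starProd (_root_.flip (C - copulaPi)) (C - copulaPi) y y = 0 := by
    intro y
    by_contra hne
    have hpos := lt_of_le_of_ne (starProd_flip_self_nonneg (C - copulaPi) y) (Ne.symm hne)
    have := intervalIntegral.integral_pos zero_lt_one hc.continuousOn
      (fun t _ => starProd_flip_self_nonneg (C - copulaPi) _)
      ⟨y, y.2, by simpa only [clampI_of_mem] using hpos⟩
    rw [← energyFst_eq, hE] at this
    exact lt_irrefl _ this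
  funext x y
  have hy := hz y
  rw [starProd_flip_self] at hy
  have hi : IntervalIntegrable (fun t => (partialFst (C - copulaPi) t y) ^ 2) volume 0 1 :=
    intervalIntegrable_of_abs_le (K := ((1 + 1 : ℝ≥0) : ℝ) ^ 2)
      ((hL.measurable_partialFst _).pow_const 2) (fun t => by
        rw [abs_pow]
        exact pow_le_pow_left₀ (abs_nonneg _) (hL.abs_partialFst_le _ _) 2) 0 1
  rw [intervalIntegral.integral_eq_zero_iff_of_le_of_nonneg_ae zero_le_one
    (ae_of_all _ fun t => sq_nonneg _) hi] at hy
  have h0 : (C - copulaPi) x y - (C - copulaPi) 0 y = 0 := by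
    have := hL.integral_partialFst y 0 x
    rw [clampI_of_mem, clampI_zero] at this
    rw [← this, intervalIntegral.integral_of_le x.2.1]
    refine integral_eq_zero_of_ae ?_
    filter_upwards [ae_restrict_of_ae_restrict_of_subset
      (Set.Ioc_subset_Ioc_right x.2.2) hy] with t ht
    exact pow_eq_zero_iff two_ne_zero |>.1 ht
  have h1 : (C - copulaPi) 0 y = 0 := by
    simp [hC.left_zero, copulaPi]
  rw [h1, sub_zero] at h0
  exact sub_eq_zero.1 h0

end IsCopula

/-! ### Invertible copulas and the star norm -/

theorem isInvertibleCopula_copulaM : IsInvertibleCopula copulaM :=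
  ⟨isCopula_copulaM, copulaM, isCopula_copulaM, isCopula_copulaM.copulaM_starProd,
    isCopula_copulaM.copulaM_starProd⟩

theorem IsInvertibleCopula.flip {U : unitInterval → unitInterval → ℝ}
    (hU : IsInvertibleCopula U) : IsInvertibleCopula (flip U) := by
  obtain ⟨h, V, hV, h1, h2⟩ := hU
  exact ⟨h.flip, _root_.flip V, hV.flip, by rw [starProd_flip_flip, h2, flip_copulaM],
    by rw [starProd_flip_flip, h1, flip_copulaM]⟩

theorem IsInvertibleCopula.starProd {U V : unitInterval → unitInterval → ℝ}
    (hU : IsInvertibleCopula U) (hV : IsInvertibleCopula V) :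
    IsInvertibleCopula (starProd U V) := by
  obtain ⟨hU, U', hU', hU1, hU2⟩ := hU
  obtain ⟨hV, V', hV', hV1, hV2⟩ := hV
  refine ⟨hU.starProd hV, _root_.starProd V' U', hV'.starProd hU', ?_, ?_⟩
  · rw [hV'.starProd_assoc hU' (hU.starProd hV), ← hU'.starProd_assoc hU hV, hU1,
      hV.copulaM_starProd, hV1]
  · rw [hU.starProd_assoc hV (hV'.starProd hU'), ← hV.starProd_assoc hV' hU', hV2,
      hU'.copulaM_starProd, hU2]

namespace IsCopula

variable {C D U V : unitInterval → unitInterval → ℝ}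

theorem starProd_sub_starProd (hU : IsCopula U) (hV : IsCopula V) (hC : IsCopula C)
    (hD : IsCopula D) : _root_.starProd (_root_.starProd U (C - D)) V =
      _root_.starProd (_root_.starProd U C) V - _root_.starProd (_root_.starProd U D) V := by
  rw [starProd_sub_right hU.sepLipschitz hC.sepLipschitz hD.sepLipschitz,
    starProd_sub_left hV.sepLipschitz (hU.starProd hC).sepLipschitz
      (hU.starProd hD).sepLipschitz]

theorem starProd_sub_copulaPi_starProd (hU : IsCopula U) (hV : IsCopula V) (hC : IsCopula C) :
    _root_.starProd (_root_.starProd U (C - copulaPi)) V =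
      _root_.starProd (_root_.starProd U C) V - copulaPi := by
  rw [hU.starProd_sub_starProd hV hC isCopula_copulaPi, hU.starProd_copulaPi,
    hV.copulaPi_starProd]

theorem le_of_mem_shuffleNorms_sub_copulaPi (hC : IsCopula C) {r : ℝ}
    (hr : r ∈ shuffleNorms (C - copulaPi)) : r ≤ Real.sqrt (1 / 3) := by
  obtain ⟨U, V, hU, hV, rfl⟩ := hr
  rw [hU.1.starProd_sub_copulaPi_starProd hV.1 hC]
  exact ((hU.1.starProd hC).starProd hV.1).sobolevNorm_sub_copulaPi_le

theorem bddAbove_shuffleNorms_sub_copulaPi (hC : IsCopula C) :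
    BddAbove (shuffleNorms (C - copulaPi)) :=
  ⟨_, fun _ hr => hC.le_of_mem_shuffleNorms_sub_copulaPi hr⟩

/-- The real `sSup` of an unbounded set is 0, so this bound is what makes the supremum dominate its
elements. It follows from the triangle inequality through Π. -/
theorem bddAbove_shuffleNorms_sub (hC : IsCopula C) (hD : IsCopula D) :
    BddAbove (shuffleNorms (C - D)) := by
  refine ⟨Real.sqrt (1 / 3) + Real.sqrt (1 / 3), ?_⟩
  rintro _ ⟨U, V, hU, hV, rfl⟩
  rw [hU.1.starProd_sub_starProd hV.1 hC hD]
  have h1 := (hU.1.starProd hC).starProd hV.1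
  have h2 := (hU.1.starProd hD).starProd hV.1
  have h3 := (h1.sepLipschitz.sub h2.sepLipschitz).sobolevNorm_le_add
    (isCopula_copulaPi.sepLipschitz.sub h2.sepLipschitz)
  rw [sub_sub_sub_cancel_right, sobolevNorm_sub_comm copulaPi] at h3
  exact h3.trans (add_le_add h1.sobolevNorm_sub_copulaPi_le h2.sobolevNorm_sub_copulaPi_le)

theorem nonempty_shuffleNorms (A : unitInterval → unitInterval → ℝ) : (shuffleNorms A).Nonempty :=
  ⟨_, copulaM, copulaM, isInvertibleCopula_copulaM, isInvertibleCopula_copulaM, rfl⟩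

theorem starNorm_sub_copulaPi_le (hC : IsCopula C) :
    starNorm (C - copulaPi) ≤ Real.sqrt (1 / 3) :=
  csSup_le (nonempty_shuffleNorms _) fun _ hr => hC.le_of_mem_shuffleNorms_sub_copulaPi hr

theorem sobolevNorm_starProd_le_starNorm (hC : IsCopula C) (hU : IsInvertibleCopula U)
    (hV : IsInvertibleCopula V) :
    sobolevNorm (_root_.starProd (_root_.starProd U C) V - copulaPi) ≤
      starNorm (C - copulaPi) := by
  refine le_csSup hC.bddAbove_shuffleNorms_sub_copulaPi ⟨U, V, hU, hV, ?_⟩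
  rw [hU.1.starProd_sub_copulaPi_starProd hV.1 hC]

theorem starNorm_sub_copulaPi_le_of_forall (hC : IsCopula C) {s : ℝ}
    (h : ∀ U V, IsInvertibleCopula U → IsInvertibleCopula V →
      sobolevNorm (_root_.starProd (_root_.starProd U C) V - copulaPi) ≤ s) :
    starNorm (C - copulaPi) ≤ s := by
  refine csSup_le (nonempty_shuffleNorms _) ?_
  rintro _ ⟨U, V, hU, hV, rfl⟩
  rw [hU.1.starProd_sub_copulaPi_starProd hV.1 hC]
  exact h U V hU hV

/-- U * Cᵀ * V is the transpose of Vᵀ * C * Uᵀ, and transposing preserves invertibility and the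
Sobolev norm. -/
theorem starNorm_flip_le (hC : IsCopula C) :
    starNorm (_root_.flip C - copulaPi) ≤ starNorm (C - copulaPi) := by
  refine hC.flip.starNorm_sub_copulaPi_le_of_forall fun U V hU hV => ?_
  have h := hC.sobolevNorm_starProd_le_starNorm hV.flip hU.flip
  have h1 := (((hV.flip.1.starProd hC).starProd hU.flip.1).sepLipschitz.sub
    isCopula_copulaPi.sepLipschitz).sobolevNorm_flip
  rw [← h1] at h
  refine le_of_eq_of_le (congrArg sobolevNorm ?_) h
  rw [hV.flip.1.starProd_assoc hC hU.flip.1]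
  have h2 : _root_.starProd (_root_.starProd U (_root_.flip C)) V =
      _root_.flip (_root_.starProd (_root_.flip V) (_root_.starProd C (_root_.flip U))) := by
    rw [← starProd_flip_flip, ← starProd_flip_flip]
    rfl
  rw [h2]
  conv_lhs => rw [← flip_copulaPi]
  rfl

theorem starNorm_flip (hC : IsCopula C) :
    starNorm (_root_.flip C - copulaPi) = starNorm (C - copulaPi) :=
  le_antisymm hC.starNorm_flip_le hC.flip.starNorm_flip_le

/-- A shuffle of a shuffle of C is again a shuffle of C. -/
theorem starNorm_starProd_le (hC : IsCopula C) (hU : IsInvertibleCopula U)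
    (hV : IsInvertibleCopula V) :
    starNorm (_root_.starProd (_root_.starProd U C) V - copulaPi) ≤ starNorm (C - copulaPi) := by
  refine ((hU.1.starProd hC).starProd hV.1).starNorm_sub_copulaPi_le_of_forall
    fun U' V' hU' hV' => ?_
  have h := hC.sobolevNorm_starProd_le_starNorm (hU'.starProd hU) (hV.starProd hV')
  rwa [hU'.1.starProd_assoc hU.1 hC, ← (hU'.1.starProd (hU.1.starProd hC)).starProd_assoc hV.1
    hV'.1, hU'.1.starProd_assoc (hU.1.starProd hC) hV.1] at h

/-- The triangle inequality for the `*`-norm. -/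
theorem starNorm_sub_copulaPi_le_add (hC : IsCopula C) (hD : IsCopula D) :
    starNorm (C - copulaPi) ≤ starNorm (C - D) + starNorm (D - copulaPi) := by
  refine hC.starNorm_sub_copulaPi_le_of_forall fun U V hU hV => ?_
  have h1 := (hU.1.starProd hC).starProd hV.1
  have h2 := (hU.1.starProd hD).starProd hV.1
  have hp := isCopula_copulaPi
  have h3 := (h1.sepLipschitz.sub hp.sepLipschitz).sobolevNorm_le_add
    (h2.sepLipschitz.sub hp.sepLipschitz)
  rw [sub_sub_sub_cancel_right] at h3
  refine h3.trans (add_le_add ?_ (hD.sobolevNorm_starProd_le_starNorm hU hV))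
  refine le_csSup (hC.bddAbove_shuffleNorms_sub hD) ⟨U, V, hU, hV, ?_⟩
  rw [hU.1.starProd_sub_starProd hV.1 hC hD]

theorem shuffleNorms_sub_comm (hC : IsCopula C) (hD : IsCopula D) :
    shuffleNorms (C - D) = shuffleNorms (D - C) := by
  have : ∀ {C D : unitInterval → unitInterval → ℝ}, IsCopula C → IsCopula D →
      shuffleNorms (C - D) ⊆ shuffleNorms (D - C) := by
    rintro C D hC hD _ ⟨U, V, hU, hV, rfl⟩
    refine ⟨U, V, hU, hV, ?_⟩
    rw [hU.1.starProd_sub_starProd hV.1 hC hD, hU.1.starProd_sub_starProd hV.1 hD hC,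
      sobolevNorm_sub_comm]
  exact Set.Subset.antisymm (this hC hD) (this hD hC)

theorem abs_starNorm_sub_le (hC : IsCopula C) (hD : IsCopula D) :
    |starNorm (C - copulaPi) - starNorm (D - copulaPi)| ≤ starNorm (C - D) := by
  have h1 := hC.starNorm_sub_copulaPi_le_add hD
  have h2 := hD.starNorm_sub_copulaPi_le_add hC
  have h3 : starNorm (D - C) = starNorm (C - D) := congrArg sSup (hD.shuffleNorms_sub_comm hC)
  rw [abs_le]
  constructor <;> linarith

theorem starNorm_sub_copulaPi_eq_zero_iff (hC : IsCopula C) :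
    starNorm (C - copulaPi) = 0 ↔ C = copulaPi := by
  constructor
  · intro h
    have := hC.sobolevNorm_starProd_le_starNorm isInvertibleCopula_copulaM
      isInvertibleCopula_copulaM
    rw [hC.copulaM_starProd, hC.starProd_copulaM, h] at this
    exact hC.eq_copulaPi_of_sobolevNorm_eq_zero (le_antisymm this (sobolevNorm_nonneg _))
  · rintro rfl
    refine le_antisymm (hC.starNorm_sub_copulaPi_le_of_forall fun U V hU hV => ?_) ?_
    · rw [hU.1.starProd_copulaPi, hV.1.copulaPi_starProd, sub_self]
      simp [sobolevNorm, partialFst, partialSnd]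
    · exact Real.sSup_nonneg fun r ⟨_, _, _, _, hr⟩ => hr ▸ sobolevNorm_nonneg _

end IsCopula

/-! ### Invertible copulas from injective maps; independence -/

theorem completelyDependentOn_comp {Ω : Type*} [MeasurableSpace Ω] {P : Measure Ω}
    {X : Ω → ℝ} {f : ℝ → ℝ} (hf : Measurable f) :
    CompletelyDependentOn P (f ∘ X) X :=
  ⟨f, hf, ae_of_all _ fun _ => rfl⟩

/-- By the Lusin–Souslin theorem f is a measurable embedding, so its inverse on the range extends to
a Borel function. -/
theorem completelyDependentOn_of_injective {Ω : Type*} [MeasurableSpace Ω] {P : Measure Ω}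
    {X : Ω → ℝ} {f : ℝ → ℝ} (hf : Measurable f) (hinj : Function.Injective f) :
    CompletelyDependentOn P X (f ∘ X) := by
  obtain ⟨g, hg, hgf⟩ := (hf.measurableEmbedding hinj).exists_measurable_extend measurable_id
    fun _ => ⟨0⟩
  exact ⟨g, hg, ae_of_all _ fun ω => (congrFun hgf (X ω)).symm⟩

section

variable {Ω : Type*} [MeasurableSpace Ω] {P : Measure Ω} [IsProbabilityMeasure P]
  {X Y Z : Ω → ℝ}

theorem copulaOf_self (hX : IsContinuousRV P X) : copulaOf P X X = copulaM := by
  funext u v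
  simp only [copulaOf, ← le_min_iff, prob_distFun_le P hX (min u v), copulaM]
  exact Monotone.map_min (f := ((↑) : unitInterval → ℝ)) fun _ _ h => h

/-- C_{X,Z} is the inverse: the two products are C_{X,X} and C_{Z,Z}, both equal to M. -/
theorem isInvertibleCopula_copulaOf (hX : IsContinuousRV P X) (hZ : IsContinuousRV P Z)
    (hZX : CompletelyDependentOn P Z X) (hXZ : CompletelyDependentOn P X Z) :
    IsInvertibleCopula (copulaOf P Z X) :=
  ⟨isCopula_copulaOf hZ hX, copulaOf P X Z, isCopula_copulaOf hX hZ,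
    by rw [hXZ.starProd_copulaOf hZ hX hX, copulaOf_self hX],
    by rw [hZX.starProd_copulaOf hX hZ hZ, copulaOf_self hZ]⟩

/-- The absence of atoms is visibly stable under injective maps, unlike continuity of the
distribution function. -/
theorem isContinuousRV_iff : IsContinuousRV P X ↔ Measurable X ∧ ∀ x, P (X ⁻¹' {x}) = 0 := by
  refine and_congr_right fun hm => ?_
  have := Measure.isProbabilityMeasure_map (μ := P) hm.aemeasurable
  have h1 : Continuous (distFun P X) ↔ Continuous (cdf (P.map X)) := by
    rw [continuous_induced_rng]
    exact iff_of_eq (congrArg Continuous (funext fun x => distFun_coe_eq_cdf P hm x))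
  rw [h1, continuous_iff_continuousAt]
  refine forall_congr' fun x => ?_
  rw [← Measure.map_apply hm (measurableSet_singleton x)]
  conv_rhs => rw [← measure_cdf (P.map X)]
  rw [StieltjesFunction.measure_singleton, ENNReal.ofReal_eq_zero, sub_nonpos,
    (cdf (P.map X)).mono.continuousAt_iff_leftLim_eq_rightLim, StieltjesFunction.rightLim_eq]
  exact ⟨fun h => h.ge, fun h => le_antisymm ((cdf (P.map X)).mono.leftLim_le le_rfl) h⟩

theorem IsContinuousRV.comp_injective (hX : IsContinuousRV P X) {f : ℝ → ℝ} (hf : Measurable f)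
    (hinj : Function.Injective f) : IsContinuousRV P (f ∘ X) := by
  rw [isContinuousRV_iff] at hX ⊢
  refine ⟨hf.comp hX.1, fun z => ?_⟩
  by_cases hz : ∃ x, f x = z
  · obtain ⟨x, rfl⟩ := hz
    rw [← hX.2 x]
    congr 1
    ext ω
    simp [hinj.eq_iff]
  · have : f ∘ X ⁻¹' {z} = ∅ := by
      ext ω
      simpa using fun h => hz ⟨X ω, h⟩
    rw [this, measure_empty]

theorem IsContinuousRV.isInvertibleCopula_comp (hX : IsContinuousRV P X) {f : ℝ → ℝ}
    (hf : Measurable f) (hinj : Function.Injective f) :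
    IsInvertibleCopula (copulaOf P (f ∘ X) X) :=
  isInvertibleCopula_copulaOf hX (hX.comp_injective hf hinj) (completelyDependentOn_comp hf)
    (completelyDependentOn_of_injective hf hinj)

theorem indepFun_of_forall_le (hX : Measurable X) (hY : Measurable Y)
    (h : ∀ x y, P {ω | X ω ≤ x ∧ Y ω ≤ y} = P {ω | X ω ≤ x} * P {ω | Y ω ≤ y}) :
    IndepFun X Y P := by
  have hb : (inferInstance : MeasurableSpace ℝ) =
      MeasurableSpace.generateFrom (Set.range Set.Iic) := by
    rw [← borel_eq_generateFrom_Iic ℝ]; exact BorelSpace.measurable_eq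
  have hg : ∀ Z : Ω → ℝ, MeasurableSpace.comap Z inferInstance =
      MeasurableSpace.generateFrom (Set.preimage Z '' Set.range Set.Iic) := fun Z => by
    rw [hb, MeasurableSpace.comap_generateFrom]
  have hp : ∀ Z : Ω → ℝ, IsPiSystem (Set.preimage Z '' Set.range Set.Iic) := fun Z =>
    isPiSystem_Iic.comap Z
  refine IndepSets.indep hX.comap_le hY.comap_le (hp X) (hp Y) (hg X) (hg Y) ?_
  rw [IndepSets_iff]
  rintro _ _ ⟨_, ⟨x, rfl⟩, rfl⟩ ⟨_, ⟨y, rfl⟩, rfl⟩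
  exact h x y

theorem copulaOf_eq_copulaPi_iff (hX : IsContinuousRV P X) (hY : IsContinuousRV P Y) :
    copulaOf P X Y = copulaPi ↔ IndepFun X Y P := by
  constructor
  · intro h
    refine indepFun_of_forall_le hX.1 hY.1 fun x y => ?_
    have := (isCopulaOf_copulaOf P hX hY).2 x y
    rw [h] at this
    rw [← ENNReal.toReal_eq_toReal_iff' (measure_ne_top _ _)
      (ENNReal.mul_ne_top (measure_ne_top _ _) (measure_ne_top _ _)), ENNReal.toReal_mul]
    exact this
  · intro h
    refine (IsCopulaOf.eq_copulaOf hX hY ⟨isCopula_copulaPi, fun x y => ?_⟩).symm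
    have := h.measure_inter_preimage_eq_mul _ _ (measurableSet_Iic (a := x))
      (measurableSet_Iic (a := y))
    exact (congrArg ENNReal.toReal this).trans ENNReal.toReal_mul

/-- C_{f(X),g(Y)} = C_{f(X),X} * C_{X,Y} * C_{Y,g(Y)} has invertible outer factors, which gives one
inequality. Dependence is mutual, so exchanging roles gives the other. -/
theorem starNorm_copulaOf_comp (hX : IsContinuousRV P X) (hY : IsContinuousRV P Y) {f g : ℝ → ℝ}
    (hf : Measurable f) (hfi : Function.Injective f) (hg : Measurable g)
    (hgi : Function.Injective g) :
    starNorm (copulaOf P (f ∘ X) (g ∘ Y) - copulaPi) = starNorm (copulaOf P X Y - copulaPi) := by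
  have hX' := hX.comp_injective hf hfi
  have hY' := hY.comp_injective hg hgi
  have dX := completelyDependentOn_comp (P := P) (X := X) hf
  have dY := completelyDependentOn_comp (P := P) (X := Y) hg
  have dX' := completelyDependentOn_of_injective (P := P) (X := X) hf hfi
  have dY' := completelyDependentOn_of_injective (P := P) (X := Y) hg hgi
  have key : ∀ {X₁ X₂ Y₁ Y₂ : Ω → ℝ}, IsContinuousRV P X₁ → IsContinuousRV P X₂ →
      IsContinuousRV P Y₁ → IsContinuousRV P Y₂ → CompletelyDependentOn P X₂ X₁ →
      CompletelyDependentOn P X₁ X₂ → CompletelyDependentOn P Y₂ Y₁ →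
      CompletelyDependentOn P Y₁ Y₂ →
      starNorm (copulaOf P X₂ Y₂ - copulaPi) ≤ starNorm (copulaOf P X₁ Y₁ - copulaPi) := by
    intro X₁ X₂ Y₁ Y₂ hX₁ hX₂ hY₁ hY₂ d1 d1' d2 d2'
    have h := (isCopula_copulaOf hX₁ hY₁).starNorm_starProd_le
      (isInvertibleCopula_copulaOf hX₁ hX₂ d1 d1') (isInvertibleCopula_copulaOf hY₂ hY₁ d2' d2)
    have h2 : starProd (copulaOf P X₂ Y₁) (copulaOf P Y₁ Y₂) = copulaOf P X₂ Y₂ := by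
      have := d2.starProd_copulaOf hY₁ hY₂ hX₂
      rw [← flip_copulaOf (X := Y₁), ← flip_copulaOf (X := X₂) (Y := Y₁),
        starProd_flip_flip, ← flip_copulaOf (X := X₂) (Y := Y₂)] at this
      exact congrArg flip this
    rwa [d1.starProd_copulaOf hX₁ hX₂ hY₁, h2] at h
  exact le_antisymm (key hX hX' hY hY' dX dX' dY dY') (key hX' hX hY' hY dX' dX dY' dY)

/-! ### Complete dependence -/

/-- If `Y = h(X)`, then some shuffle of `C_{X,Y}` is uniformly close to `M`. -/
theorem exists_shuffle_near_copulaM (hX : IsContinuousRV P X) (hY : IsContinuousRV P Y)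
    (hYX : CompletelyDependentOn P Y X) (n : ℕ) :
    ∃ U, IsInvertibleCopula U ∧
      starProd (flip (starProd U (copulaOf P X Y))) (starProd U (copulaOf P X Y)) = copulaM ∧
      ∀ u v : unitInterval, (v : ℝ) + 1 / ((n : ℝ) + 1) ≤ u →
        starProd U (copulaOf P X Y) u v = v := by
  obtain ⟨h, hh, hhX⟩ := hYX
  -- The floor sorts X by the block of length 1/(n+1) that contains G(Y). The sigmoid lies in (0,1)
  -- and is recovered as the fractional part, so f is injective.
  set f : ℝ → ℝ := fun x => (⌊((n : ℝ) + 1) * distFun P Y (h x)⌋ : ℝ) + Real.sigmoid x with hf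
  have hfm : Measurable f := by
    have h1 : Measurable fun x => ((n : ℝ) + 1) * distFun P Y (h x) :=
      (hY.measurable_coe_distFun.comp hh).const_mul _
    exact (measurable_from_top.comp (Int.measurable_floor.comp h1)).add
      Real.sigmoid_monotone.measurable
  have hfi : Function.Injective f := by
    intro x x' hxx
    have hs : ∀ x, Int.fract (f x) = Real.sigmoid x := fun x => by
      rw [hf]
      simp only [Int.fract_intCast_add]
      exact Int.fract_eq_self.2 ⟨Real.sigmoid_nonneg x, Real.sigmoid_lt_one x⟩
    exact Real.sigmoid_injective (by rw [← hs, ← hs, hxx])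
  have hZ := hX.comp_injective hfm hfi
  have dZX := completelyDependentOn_comp (P := P) (X := X) hfm
  have dXZ := completelyDependentOn_of_injective (P := P) (X := X) hfm hfi
  have dYZ : CompletelyDependentOn P Y (f ∘ X) := by
    obtain ⟨g, hg, hgX⟩ := dXZ
    refine ⟨h ∘ g, hh.comp hg, ?_⟩
    filter_upwards [hhX, hgX] with ω h1 h2
    rw [h1, Function.comp_apply, ← h2]
  have hn : (0 : ℝ) < (n : ℝ) + 1 := by positivity
  refine ⟨copulaOf P (f ∘ X) X, hX.isInvertibleCopula_comp hfm hfi, ?_, fun u v huv => ?_⟩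
  · rw [dZX.starProd_copulaOf hX hZ hY, flip_copulaOf, dYZ.starProd_copulaOf hZ hY hY,
      copulaOf_self hY]
  rw [dZX.starProd_copulaOf hX hZ hY, ← prob_distFun_le P hY v]
  -- It suffices that, almost surely, G(Y) ≤ v already forces the transform of f(X) to be at most u.
  refine measureReal_congr ?_
  filter_upwards [hhX] with ω hω
  refine propext ⟨fun h => h.2, fun hv => ⟨?_, hv⟩⟩
  have hv : (distFun P Y (Y ω) : ℝ) ≤ v := hv
  set m : ℤ := ⌊((n : ℝ) + 1) * v⌋ with hm
  have hZω : f (X ω) ≤ m + 1 := by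
    have h1 : ⌊((n : ℝ) + 1) * distFun P Y (h (X ω))⌋ ≤ m := by
      rw [← hω]
      exact Int.floor_le_floor (mul_le_mul_of_nonneg_left hv hn.le)
    have h2 := (Real.sigmoid_lt_one (X ω)).le
    have h3 : (⌊((n : ℝ) + 1) * distFun P Y (h (X ω))⌋ : ℝ) ≤ m := by exact_mod_cast h1
    exact add_le_add h3 h2
  -- It remains to bound P(f(X) ≤ m + 1) by u. Almost surely this event forces (n+1) G(Y) < m + 1,
  -- hence G(Y) ≤ v + 1/(n+1) ≤ u, an event of probability u.
  refine (distFun_mono P (f ∘ X) hZω).trans ?_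
  refine Subtype.coe_le_coe.1 ?_
  rw [← prob_distFun_le P hY u]
  refine ENNReal.toReal_mono (measure_ne_top _ _) (measure_mono_ae ?_)
  filter_upwards [hhX] with ω' hω' hle
  have hle : f (X ω') ≤ m + 1 := hle
  have h1 : (⌊((n : ℝ) + 1) * distFun P Y (h (X ω'))⌋ : ℝ) < m + 1 :=
    lt_of_lt_of_le (lt_add_of_pos_right _ (Real.sigmoid_pos _)) hle
  have h2 : ⌊((n : ℝ) + 1) * distFun P Y (h (X ω'))⌋ ≤ m :=
    Int.lt_add_one_iff.1 (by exact_mod_cast h1)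
  have h3 : ((n : ℝ) + 1) * distFun P Y (Y ω') < m + 1 := by
    rw [hω']
    exact_mod_cast Int.floor_le_iff.1 h2
  have h4 : (m : ℝ) ≤ ((n : ℝ) + 1) * v := Int.floor_le _
  have h5 : (distFun P Y (Y ω') : ℝ) ≤ v + 1 / ((n : ℝ) + 1) := by
    rw [← mul_le_mul_iff_right₀ hn, mul_add, mul_one_div_cancel hn.ne']
    linarith
  exact Subtype.coe_le_coe.1 (h5.trans huv)

/-- For the sorted shuffle, with V = M, the ∂₁ energy is exactly 1/6 and the ∂₂ energy at least 1/6
- 1/(n+1). Letting n grow attains the upper bound as a supremum. -/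
theorem starNorm_of_completelyDependentOn (hX : IsContinuousRV P X) (hY : IsContinuousRV P Y)
    (hYX : CompletelyDependentOn P Y X) :
    starNorm (copulaOf P X Y - copulaPi) = Real.sqrt (1 / 3) := by
  have hC := isCopula_copulaOf hX hY
  refine le_antisymm hC.starNorm_sub_copulaPi_le ?_
  have hlim : Tendsto (fun n : ℕ => Real.sqrt (1 / 3 - 1 / ((n : ℝ) + 1))) atTop
      (𝓝 (Real.sqrt (1 / 3))) := by
    have := (tendsto_const_nhds (x := (1 / 3 : ℝ))).sub
      (tendsto_one_div_add_atTop_nhds_zero_nat (𝕜 := ℝ))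
    rw [sub_zero] at this
    exact (Real.continuous_sqrt.tendsto _).comp this
  refine le_of_tendsto' hlim fun n => ?_
  obtain ⟨U, hU, h1, h2⟩ := exists_shuffle_near_copulaM hX hY hYX n
  have hD := hU.1.starProd hC
  have h := hC.sobolevNorm_starProd_le_starNorm hU isInvertibleCopula_copulaM
  rw [hD.starProd_copulaM,
    (hD.sepLipschitz.sub isCopula_copulaPi.sepLipschitz).sobolevNorm_eq,
    hD.energyFst_sub_copulaPi_of_starProd_eq h1] at h
  have h3 := hD.le_energyFst_flip_sub_copulaPi (by positivity) h2
  exact (Real.sqrt_le_sqrt (by linarith)).trans h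

/-! ### Properties of the measure of dependence -/

theorem omegaStar_comm (hX : IsContinuousRV P X) (hY : IsContinuousRV P Y) :
    omegaStar P X Y = omegaStar P Y X := by
  rw [omegaStar, omegaStar, ← (isCopula_copulaOf hX hY).starNorm_flip, flip_copulaOf]

theorem sqrt_three_mul_sqrt_one_third : Real.sqrt 3 * Real.sqrt (1 / 3) = 1 := by
  rw [← Real.sqrt_mul (by norm_num)]
  norm_num

theorem omegaStar_eq_one (hX : IsContinuousRV P X) (hY : IsContinuousRV P Y)
    (hYX : CompletelyDependentOn P Y X) : omegaStar P X Y = 1 := by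
  rw [omegaStar, starNorm_of_completelyDependentOn hX hY hYX, sqrt_three_mul_sqrt_one_third]

end

theorem mainTheorem7 {Ω : Type*} [MeasurableSpace Ω] (P : Measure Ω) [IsProbabilityMeasure P]
    (X Y : Ω → ℝ) (hX : IsContinuousRV P X) (hY : IsContinuousRV P Y)
    (C : unitInterval → unitInterval → ℝ) (hC : IsCopulaOf P X Y C) :
    BddAbove (shuffleNorms (C - copulaPi)) ∧
    omegaStar P X Y = omegaStar P Y X ∧
    (0 ≤ omegaStar P X Y ∧ omegaStar P X Y ≤ 1) ∧
    (omegaStar P X Y = 0 ↔ IndepFun X Y P) ∧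
    (CompletelyDependentOn P Y X ∨ CompletelyDependentOn P X Y → omegaStar P X Y = 1) ∧
    (∀ f g : ℝ → ℝ, Measurable f → Function.Bijective f → Measurable g → Function.Bijective g →
      IsContinuousRV P (f ∘ X) ∧ IsContinuousRV P (g ∘ Y) ∧
        omegaStar P (f ∘ X) (g ∘ Y) = omegaStar P X Y) ∧
    (∀ (Ω' : ℕ → Type*) [∀ n, MeasurableSpace (Ω' n)] (P' : ∀ n, Measure (Ω' n))
      [∀ n, IsProbabilityMeasure (P' n)] (X' Y' : ∀ n, Ω' n → ℝ)
      (C' : ℕ → unitInterval → unitInterval → ℝ),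
      (∀ n, IsContinuousRV (P' n) (X' n)) → (∀ n, IsContinuousRV (P' n) (Y' n)) →
      (∀ n, IsCopulaOf (P' n) (X' n) (Y' n) (C' n)) →
      Tendsto (fun n => starNorm (C' n - C)) atTop (𝓝 0) →
      Tendsto (fun n => omegaStar (P' n) (X' n) (Y' n)) atTop (𝓝 (omegaStar P X Y))) := by
  have hD := isCopula_copulaOf hX hY
  refine ⟨hC.1.bddAbove_shuffleNorms_sub_copulaPi, omegaStar_comm hX hY, ⟨?_, ?_⟩, ?_, ?_,
    fun f g hf hfb hg hgb => ⟨hX.comp_injective hf hfb.1, hY.comp_injective hg hgb.1, ?_⟩, ?_⟩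
  · exact mul_nonneg (Real.sqrt_nonneg _)
      (Real.sSup_nonneg fun r ⟨_, _, _, _, hr⟩ => hr ▸ sobolevNorm_nonneg _)
  · rw [← sqrt_three_mul_sqrt_one_third]
    exact mul_le_mul_of_nonneg_left hD.starNorm_sub_copulaPi_le (Real.sqrt_nonneg _)
  · rw [← copulaOf_eq_copulaPi_iff hX hY, ← hD.starNorm_sub_copulaPi_eq_zero_iff, omegaStar,
      mul_eq_zero, or_iff_right (by positivity)]
  · rintro (h | h)
    · exact omegaStar_eq_one hX hY h
    · rw [omegaStar_comm hX hY]
      exact omegaStar_eq_one hY hX h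
  · rw [omegaStar, omegaStar, starNorm_copulaOf_comp hX hY hf hfb.1 hg hgb.1]
  · intro Ω' _ P' _ X' Y' C' hX' hY' hC' hlim
    refine Tendsto.const_mul _ (tendsto_iff_dist_tendsto_zero.2 ?_)
    refine squeeze_zero (fun _ => dist_nonneg) (fun n => ?_) hlim
    rw [← (hC' n).eq_copulaOf (hX' n) (hY' n), ← hC.eq_copulaOf hX hY]
    exact (hC' n).1.abs_starNorm_sub_le hC.1
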